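/- **Model.** A network has nodes $1,\dots,N$, data streams $1,\dots,S$ (stream $s$ has a source node and a destination node $d(s)$ different from it), data links $l=1,\dots,L$ with transmitter $T(l)$ and receiver $R(l)$, and an energy access point (EAP) with $M$ antennas. $\mathcal O_n,\mathcal I_n$ are the sets of outgoing and ingoing links of node $n$; $N_o,N_i$ are the maxima over $n$ of $|\mathcal O_n|,|\mathcal I_n|$. In slot $t=0,1,\dots$ the channel state consists of the data link gains $g(t)=(g_l(t))_l$ and the row vectors $h_n(t)=(h_n^m(t))_{m\le M}$ of EAP-to-node gains (real or complex), with $\|h_n(t)\|\le 1$ (no node receives more power than the EAP sends). Arrivals satisfy $A_n^s(t)\in[0,A_m]$, with $A_n^s(t)=0$ unless $n$ is the source of $s$, and $\lambda_n^s=\mathbb E A_n^s(t)$. The pairs (channel state, arrivals) are i.i.d. over $t$. Link powers are chosen in a Borel set $\Pi$ of vectors $p=(p_l)$ with $p_l\ge 0$ and $\sum_{l\in\mathcal O_n}p_l\le P_m$ for all $n$; $\Pi$ is closed under setting an entry to $0$. The capacities $C_l(p,g)\in[0,C_m]$ are Borel functions and satisfy, for $p\in\Pi$, every $g$ and $p'$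 equal to $p$ with $l$-th entry set to $0$: $C_l(p',g)=0$, $C_l(p,g)\le\delta p_l$, and $C_{l'}(p,g)\le C_{l'}(p',g)$ for $l'\ne l$. Here $P_m,P_{APm},C_m,\delta>0$, $A_m\ge0$. A decision in slot $t$ consists of $p(t)\in\Pi$, a unit beamforming vector $w(t)$, an EAP power $p_{AP}(t)\in[0,P_{APm}]$ and rates $C_l^s(t)\ge 0$ with $\sum_sC_l^s(t)\le C_l(p(t),g(t))$; decisions may depend on the past, on the current slot and on extra randomness, but not on the future. With $Q_n(t)=p_{AP}(t)|w(t)h_n^T(t)|^2$, $$U_n^s(t+1)=\Big[U_n^s(t)-\sum_{l\in\mathcal O_n}C_l^s(t)\Big]^++\sum_{l\in\mathcal I_n}C_l^s(t)+A_n^s(t)\quad(n\ne d(s)),\qquad U_{d(s)}^s(t)=0,$$ $$E_n(t+1)=E_n(t)-\sum_{l\in\mathcal O_n}p_l(t)+Q_n(t).$$ Initially $U_n^s(0)\ge0$ is square integrable and $E_n(0)\ge 0$, and both are determined by the information available before slot $0$. **Capacity region.** For the given channel law, $\Lambda$ is the set of rate matrices $r=(r_n^s)$ for which some arrival process of mean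 $r$ (nonnegative, bounded, i.i.d. over slots jointly with the channels) and some non-anticipating policy give stable queues, i.e. $\limsup_T\frac1T\sum_{t<T}\sum_{n,s}\mathbb E\,U_n^s(t)<\infty$, under the average power constraint $\limsup_T\frac1T\sum_{t<T}\mathbb E\big[\sum_{l\in\mathcal O_n}p_l(t)-Q_n(t)\big]\le0$ for all $n$. $p^*_{AP}(r)$ is the infimum of $\limsup_T\frac1T\sum_{t<T}\mathbb E\,p_{AP}(t)$ over all these. **Policy.** Fix $V>0$, $\alpha>1$, $\mathcal C=\frac{2\delta}{1-1/\alpha}$, $U_0=P_m(\mathcal C+\alpha\delta)$. Call $(n,s)$ congested if $U_n^s>U_0$ and critical if $U_n^s>\max\{U_0,\mathcal CE_n\}$. Let $\pi_n^s=(U_n^s-\mathcal CE_n)\mathbf 1_{\text{critical}}+U_n^s\mathbf 1_{\text{congested}}$, $W_l^s=\pi_{T(l)}^s-\pi_{R(l)}^s$, $W_l=\max_sW_l^s$, and $J_n=\mathcal C\sum_s(U_n^s-\mathcal CE_n)\mathbf 1_{\text{critical}}$. In each slot, $p(t)$ minimizes $\sum_l[J_{T(l)}p_l-W_lC_l(p,g(t))]$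 over $p\in\Pi$, ties being broken so that $p_l(t)=0$ whenever $W_l\le0$; link $l$ gives its whole capacity to a stream attaining $W_l$; $w(t)$ is a unit eigenvector (as a row vector, $wH=\mu w$) of $H=\sum_nJ_nh_n^T\overline{h_n}$ for its largest eigenvalue; and $p_{AP}(t)=P_{APm}$ if $V<\sum_nJ_n|w(t)h_n^T(t)|^2$, else $p_{AP}(t)=0$. **Constants.** $B=NS\max\{B_0,B_1,B_2\}$ with $B_0=(U_0+A_m+N_iC_m)^2$, $$B_1=\tfrac12(N_o^2+N_i^2)C_m^2+\tfrac12A_m^2+A_mN_iC_m+\tfrac12(A_m+N_iC_m+\mathcal CN_oP_m)^2,$$ $$B_2=(N_o^2+N_i^2)C_m^2+A_m^2+2A_mN_iC_m+\tfrac12\mathcal C^2N_o^2P_m^2+\tfrac12\mathcal C^2P_{APm}^2+\mathcal CP_{APm}N_oC_m+\mathcal CN_oN_iP_mC_m+\mathcal CA_mN_oP_m,$$ and $B'=B+\epsilon_{max}NSU_0$. **Theorem.** Suppose that the arrival rates are strictly inside the capacity region: for some $\epsilon_{max}>0$ and all $\epsilon\in(0,\epsilon_{max}]$, the matrix $\lambda+\epsilon=(\lambda_n^s+\epsilon)_{n,s}$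 belongs to $\Lambda$. Then under the policy: 1. At every time-slot $t$ and for every link $l$, $p_l(t)\neq0$ only if $E_{T(l)}(t)>P_m$; hence $\sum_{l\in\mathcal O_n}p_l(t)\le E_n(t)$ for all $n,t$. 2. $\limsup_{T\to\infty}\frac1T\sum_{t<T}\mathbb E\,p_{AP}(t)\le p^*_{AP}(\lambda)+\frac BV$. 3. The queues are stable, and $\limsup_{T\to\infty}\frac1T\sum_{t<T}\sum_{n,s}\mathbb E\,U_n^s(t)\le\frac{V\,p^*_{AP}(\lambda+\epsilon_{max})+B'}{\epsilon_{max}}$. -/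

import Mathlib

open MeasureTheory ProbabilityTheory Filter

noncomputable section

/-- A wireless powered communication network with `N` battery powered nodes, `S` data streams,
`L` data links and an energy access point (EAP) with `M` antennas. Channel gains live in `𝕜`
(real or complex). -/
structure WPCN (𝕜 : Type) [RCLike 𝕜] (N S L M : ℕ) where
  /-- transmitter of a data link -/
  tx : Fin L → Fin N
  /-- receiver of a data link -/
  rx : Fin L → Fin N
  /-- source node of a stream -/
  src : Fin S → Fin N
  /-- destination node of a stream -/
  dst : Fin S → Fin N
  src_ne_dst : ∀ s, src s ≠ dst s
  /-- the set of feasible data link power vectors -/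
  feasible : Set (Fin L → ℝ)
  /-- capacity of a link under a power vector and a data channel vector -/
  cap : (Fin L → ℝ) → (Fin L → 𝕜) → Fin L → ℝ
  /-- peak transmission power of a node -/
  Pm : ℝ
  /-- peak transmission power of the EAP -/
  PAPm : ℝ
  /-- largest amount of data that arrives at a queue in one slot -/
  Am : ℝ
  /-- largest link capacity -/
  Cm : ℝ
  /-- slope of the linear bound on the rate-power function -/
  δ : ℝ
  Pm_pos : 0 < Pm
  PAPm_pos : 0 < PAPm
  Am_nonneg : 0 ≤ Am
  Cm_pos : 0 < Cm
  δ_pos : 0 < δ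
  measurableSet_feasible : MeasurableSet feasible
  measurable_cap : ∀ l, Measurable fun x : (Fin L → ℝ) × (Fin L → 𝕜) => cap x.1 x.2 l
  switchOff_mem : ∀ p ∈ feasible, ∀ l, Function.update p l 0 ∈ feasible
  power_nonneg : ∀ p ∈ feasible, ∀ l, 0 ≤ p l
  /-- the total transmission power of a node is at most `Pm` (hence so is that of each link) -/
  power_le : ∀ p ∈ feasible, ∀ n, ∑ l with tx l = n, p l ≤ Pm
  cap_nonneg : ∀ p ∈ feasible, ∀ g l, 0 ≤ cap p g l
  cap_le : ∀ p ∈ feasible, ∀ g l, cap p g l ≤ Cm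
  /-- no power, no rate -/
  cap_switchOff : ∀ p ∈ feasible, ∀ g l, cap (Function.update p l 0) g l = 0
  /-- linear bound on the rate-power function -/
  cap_le_linear : ∀ p ∈ feasible, ∀ g l, cap p g l ≤ δ * p l
  /-- switching a link off does not harm the other links -/
  interference : ∀ p ∈ feasible, ∀ g l l', l' ≠ l →
    cap p g l' ≤ cap (Function.update p l 0) g l'

/-- Channel state of one slot: the gains `g l` of the data links, and the gains `h n m` between
the EAP's antenna `m` and node `n`. -/
abbrev ChannelState (𝕜 : Type) (N L M : ℕ) : Type := (Fin L → 𝕜) × (Fin N → Fin M → 𝕜)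

/-- Data arriving in one slot: `A n s` for stream `s` at node `n`. -/
abbrev Arrivals (N S : ℕ) : Type := Fin N → Fin S → ℝ

/-- The decisions of the network controller in one slot. -/
structure Control (𝕜 : Type) (S L M : ℕ) where
  /-- data link power vector -/
  p : Fin L → ℝ
  /-- beamforming vector of the EAP -/
  w : Fin M → 𝕜
  /-- transmission power of the EAP -/
  pAP : ℝ
  /-- rate allocated to a stream over a link -/
  C : Fin L → Fin S → ℝ

/-- `(1/T) * ∑_{t < T} f t` -/
def timeAvg (f : ℕ → ℝ) (T : ℕ) : ℝ := (∑ t ∈ Finset.range T, f t) / T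

/-- `limsup_{T → ∞} (1/T) * ∑_{t < T} f t`, as an extended real -/
def limsupAvg (f : ℕ → ℝ) : EReal := limsup (fun T : ℕ => ((timeAvg f T : ℝ) : EReal)) atTop

namespace WPCN

variable {𝕜 : Type} [RCLike 𝕜] {N S L M : ℕ}

/-! ### Dynamics -/

/-- The beamforming gain `|w hₙᵀ|²` of node `n`. -/
def beamGain (w : Fin M → 𝕜) (h : Fin N → Fin M → 𝕜) (n : Fin N) : ℝ :=
  ‖∑ m, w m * h n m‖ ^ 2

/-- The power `Qₙ` received by node `n`. -/
def received (c : Control 𝕜 S L M) (h : Fin N → Fin M → 𝕜) (n : Fin N) : ℝ :=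
  c.pAP * beamGain c.w h n

/-- Total transmission power of node `n`. -/
def spent (net : WPCN 𝕜 N S L M) (c : Control 𝕜 S L M) (n : Fin N) : ℝ :=
  ∑ l with net.tx l = n, c.p l

/-- Feasibility of a decision under data channel vector `g`. -/
structure IsFeasible (net : WPCN 𝕜 N S L M) (g : Fin L → 𝕜) (c : Control 𝕜 S L M) : Prop where
  power : c.p ∈ net.feasible
  beam : ∑ m, ‖c.w m‖ ^ 2 = 1
  pAP_nonneg : 0 ≤ c.pAP
  pAP_le : c.pAP ≤ net.PAPm
  rate_nonneg : ∀ l s, 0 ≤ c.C l s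
  rate_le : ∀ l, ∑ s, c.C l s ≤ net.cap c.p g l

/-- Queue backlogs after one slot. Data that reaches its destination leaves the network, so the
queue of a stream at its destination is always empty. -/
def nextQueue (net : WPCN 𝕜 N S L M) (c : Control 𝕜 S L M) (A : Arrivals N S)
    (U : Fin N → Fin S → ℝ) (n : Fin N) (s : Fin S) : ℝ :=
  if n = net.dst s then 0
  else max (U n s - ∑ l with net.tx l = n, c.C l s) 0 + ∑ l with net.rx l = n, c.C l s + A n s

/-- Battery levels after one slot. -/
def nextBattery (net : WPCN 𝕜 N S L M) (c : Control 𝕜 S L M) (h : Fin N → Fin M → 𝕜)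
    (E : Fin N → ℝ) (n : Fin N) : ℝ :=
  E n - net.spent c n + received c h n

/-- The pairs (channel state, arrivals) are i.i.d. over time-slots and the channel state has law
`ν`. Here `ℱ t` is the information available before slot `t`; the pair of slot `t` is revealed
during the slot and is independent of `ℱ t`. -/
structure IsIIDInput {Ω : Type*} [mΩ : MeasurableSpace Ω] (μ : Measure Ω) (ℱ : Filtration ℕ mΩ)
    (ν : Measure (ChannelState 𝕜 N L M)) (ch : ℕ → Ω → ChannelState 𝕜 N L M)
    (A : ℕ → Ω → Arrivals N S) : Prop where
  adapted : ∀ t, Measurable[ℱ (t + 1)] fun ω => (ch t ω, A t ω)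
  indep : ∀ t, Indep (MeasurableSpace.comap (fun ω => (ch t ω, A t ω)) inferInstance) (ℱ t) μ
  ident : ∀ t, IdentDistrib (fun ω => (ch t ω, A t ω)) (fun ω => (ch 0 ω, A 0 ω)) μ μ
  law : μ.map (ch 0) = ν

/-- The backlog process `U` results from a non-anticipating (possibly randomized and history
dependent) sequence `c` of feasible decisions. -/
structure IsQueueProcess (net : WPCN 𝕜 N S L M) {Ω : Type*} [mΩ : MeasurableSpace Ω]
    (μ : Measure Ω) (ℱ : Filtration ℕ mΩ) (ch : ℕ → Ω → ChannelState 𝕜 N L M)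
    (A : ℕ → Ω → Arrivals N S) (c : ℕ → Ω → Control 𝕜 S L M)
    (U : ℕ → Ω → Fin N → Fin S → ℝ) : Prop where
  measurable_p : ∀ t, Measurable[ℱ (t + 1)] fun ω => (c t ω).p
  measurable_w : ∀ t, Measurable[ℱ (t + 1)] fun ω => (c t ω).w
  measurable_pAP : ∀ t, Measurable[ℱ (t + 1)] fun ω => (c t ω).pAP
  measurable_C : ∀ t, Measurable[ℱ (t + 1)] fun ω => (c t ω).C
  isFeasible : ∀ t ω, net.IsFeasible (ch t ω).1 (c t ω)
  init_measurable : Measurable[ℱ 0] (U 0)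
  init_nonneg : ∀ ω n s, 0 ≤ U 0 ω n s
  init_dst : ∀ ω s, U 0 ω (net.dst s) s = 0
  init_integrable : ∀ n s, Integrable (fun ω => U 0 ω n s) μ
  step : ∀ t ω n s, U (t + 1) ω n s = net.nextQueue (c t ω) (A t ω) (U t ω) n s

/-! ### Capacity region and minimum power -/

/-- The long run average of the expected total backlog. -/
def avgBacklog {Ω : Type*} [MeasurableSpace Ω] (μ : Measure Ω)
    (U : ℕ → Ω → Fin N → Fin S → ℝ) : EReal :=
  limsupAvg fun t => ∑ n, ∑ s, ∫ ω, U t ω n s ∂μ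

/-- The long run average of the expected EAP power. -/
def avgPower {Ω : Type*} [MeasurableSpace Ω] (μ : Measure Ω)
    (c : ℕ → Ω → Control 𝕜 S L M) : EReal :=
  limsupAvg fun t => ∫ ω, (c t ω).pAP ∂μ

/-- Channels of law `ν` and arrivals of rates `r n s` (for stream `s` at node `n`) can be handled
by some non-anticipating policy such that all queues are stable, every node satisfies the average
power constraint (it spends on average at most what it receives), and the average EAP power is at
most `P`. -/
def StabilizableWith (net : WPCN 𝕜 N S L M) (ν : Measure (ChannelState 𝕜 N L M))
    (r : Fin N → Fin S → ℝ) (P : ℝ) : Prop :=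
  ∃ (Ω : Type) (mΩ : MeasurableSpace Ω) (μ : Measure Ω) (_ : IsProbabilityMeasure μ)
    (ℱ : Filtration ℕ mΩ) (ch : ℕ → Ω → ChannelState 𝕜 N L M) (A : ℕ → Ω → Arrivals N S)
    (c : ℕ → Ω → Control 𝕜 S L M) (U : ℕ → Ω → Fin N → Fin S → ℝ),
    IsIIDInput μ ℱ ν ch A ∧
    (∃ a : ℝ, ∀ t ω n s, 0 ≤ A t ω n s ∧ A t ω n s ≤ a) ∧
    (∀ n s, ∫ ω, A 0 ω n s ∂μ = r n s) ∧
    net.IsQueueProcess μ ℱ ch A c U ∧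
    avgBacklog μ U < ⊤ ∧
    (∀ n, limsupAvg (fun t =>
      ∫ ω, net.spent (c t ω) n ∂μ - ∫ ω, received (c t ω) (ch t ω).2 n ∂μ) ≤ 0) ∧
    avgPower μ c ≤ (P : EReal)

/-- The capacity region: the arrival rates that can be stabilized under the average power
constraint. -/
def capacityRegion (net : WPCN 𝕜 N S L M) (ν : Measure (ChannelState 𝕜 N L M)) :
    Set (Fin N → Fin S → ℝ) :=
  {r | ∃ P, net.StabilizableWith ν r P}

/-- The minimum average EAP power required for stability at arrival rates `r`. -/
def minPower (net : WPCN 𝕜 N S L M) (ν : Measure (ChannelState 𝕜 N L M))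
    (r : Fin N → Fin S → ℝ) : ℝ :=
  sInf {P | net.StabilizableWith ν r P}

/-! ### The proposed policy -/

/-- The energy normalization factor `𝒞`. -/
def energyFactor (net : WPCN 𝕜 N S L M) (α : ℝ) : ℝ := 2 * net.δ / (1 - 1 / α)

/-- The congestion threshold `U₀`. -/
def threshold (net : WPCN 𝕜 N S L M) (α : ℝ) : ℝ :=
  net.Pm * (net.energyFactor α + α * net.δ)

/-- The queue of stream `s` at node `n` is congested. -/
def Congested (net : WPCN 𝕜 N S L M) (α : ℝ) (U : Fin N → Fin S → ℝ) (n : Fin N) (s : Fin S) :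
    Prop :=
  net.threshold α < U n s

/-- The queue of stream `s` at node `n` is critically congested. -/
def Critical (net : WPCN 𝕜 N S L M) (α : ℝ) (U : Fin N → Fin S → ℝ) (E : Fin N → ℝ)
    (n : Fin N) (s : Fin S) : Prop :=
  max (net.threshold α) (net.energyFactor α * E n) < U n s

open Classical in
/-- `(U n s - 𝒞 E n) 1_{critical} + U n s 1_{congested}` -/
def pressure (net : WPCN 𝕜 N S L M) (α : ℝ) (U : Fin N → Fin S → ℝ) (E : Fin N → ℝ)
    (n : Fin N) (s : Fin S) : ℝ :=
  (if net.Critical α U E n s then U n s - net.energyFactor α * E n else 0) +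
    (if net.Congested α U n s then U n s else 0)

/-- The data coefficient of stream `s` over link `l`. -/
def dataCoeff (net : WPCN 𝕜 N S L M) (α : ℝ) (U : Fin N → Fin S → ℝ) (E : Fin N → ℝ)
    (l : Fin L) (s : Fin S) : ℝ :=
  net.pressure α U E (net.tx l) s - net.pressure α U E (net.rx l) s

open Classical in
/-- The power coefficient of node `n`. -/
def powerCoeff (net : WPCN 𝕜 N S L M) (α : ℝ) (U : Fin N → Fin S → ℝ) (E : Fin N → ℝ)
    (n : Fin N) : ℝ :=
  net.energyFactor α *
    ∑ s, if net.Critical α U E n s then U n s - net.energyFactor α * E n else 0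

/-- The objective `∑ₗ (J_{T(l)} pₗ - Wₗ Cₗ(p, g))` of the data link control. -/
def linkObjective (net : WPCN 𝕜 N S L M) (J : Fin N → ℝ) (W : Fin L → ℝ) (g : Fin L → 𝕜)
    (p : Fin L → ℝ) : ℝ :=
  ∑ l, (J (net.tx l) * p l - W l * net.cap p g l)

/-- Data link control: every link serves a stream `σ l` of maximal data coefficient with its whole
capacity, and the power vector minimizes the link objective over the feasible ones. Ties are
broken in favour of not transmitting: a link whose maximal data coefficient is not positive gets
no power (from any minimizer, switching such links off yields a minimizer). -/
def DataLinkControl (net : WPCN 𝕜 N S L M) (α : ℝ) (U : Fin N → Fin S → ℝ) (E : Fin N → ℝ)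
    (g : Fin L → 𝕜) (c : Control 𝕜 S L M) : Prop :=
  ∃ σ : Fin L → Fin S,
    (∀ l s, net.dataCoeff α U E l s ≤ net.dataCoeff α U E l (σ l)) ∧
    c.p ∈ net.feasible ∧
    (∀ q ∈ net.feasible,
      net.linkObjective (net.powerCoeff α U E) (fun l => net.dataCoeff α U E l (σ l)) g c.p ≤
      net.linkObjective (net.powerCoeff α U E) (fun l => net.dataCoeff α U E l (σ l)) g q) ∧
    (∀ l, net.dataCoeff α U E l (σ l) ≤ 0 → c.p l = 0) ∧
    (∀ l s, c.C l s = if s = σ l then net.cap c.p g l else 0)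

/-- The sum channel matrix `H = ∑ₙ Jₙ hₙᵀ h̄ₙ` (`h̄ₙ = hₙ` for real channels). -/
def sumChannel (J : Fin N → ℝ) (h : Fin N → Fin M → 𝕜) : Matrix (Fin M) (Fin M) 𝕜 :=
  ∑ n, (J n : 𝕜) • Matrix.vecMulVec (h n) (star (h n))

/-- The row vector `w` is a normalized eigenvector of `H` for the largest eigenvalue. -/
def IsLeadingEigenvector (H : Matrix (Fin M) (Fin M) 𝕜) (w : Fin M → 𝕜) : Prop :=
  ∑ m, ‖w m‖ ^ 2 = 1 ∧
  ∃ a : ℝ, Matrix.vecMul w H = (a : 𝕜) • w ∧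
    ∀ (b : ℝ) (v : Fin M → 𝕜), v ≠ 0 → Matrix.vecMul v H = (b : 𝕜) • v → b ≤ a

open Classical in
/-- Energy link control: beamforming along a leading eigenvector of the sum channel matrix, and
full EAP power if and only if `V < ∑ₙ |w hₙᵀ|² Jₙ`. -/
def EnergyLinkControl (net : WPCN 𝕜 N S L M) (α V : ℝ) (U : Fin N → Fin S → ℝ) (E : Fin N → ℝ)
    (h : Fin N → Fin M → 𝕜) (c : Control 𝕜 S L M) : Prop :=
  IsLeadingEigenvector (sumChannel (net.powerCoeff α U E) h) c.w ∧
  c.pAP = if V < ∑ n, beamGain c.w h n * net.powerCoeff α U E n then net.PAPm else 0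

/-- The network, with backlogs `U` and battery levels `E`, is run under the proposed policy with
parameters `α` and `V`. -/
structure RunsProposedPolicy (net : WPCN 𝕜 N S L M) (α V : ℝ) {Ω : Type*}
    [mΩ : MeasurableSpace Ω] (μ : Measure Ω) (ℱ : Filtration ℕ mΩ)
    (ch : ℕ → Ω → ChannelState 𝕜 N L M) (A : ℕ → Ω → Arrivals N S)
    (c : ℕ → Ω → Control 𝕜 S L M) (U : ℕ → Ω → Fin N → Fin S → ℝ) (E : ℕ → Ω → Fin N → ℝ) :
    Prop where
  queue : net.IsQueueProcess μ ℱ ch A c U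
  init_sq : ∀ n s, MemLp (fun ω => U 0 ω n s) 2 μ
  battery_measurable : Measurable[ℱ 0] (E 0)
  battery_nonneg : ∀ ω n, 0 ≤ E 0 ω n
  battery_step : ∀ t ω n, E (t + 1) ω n = net.nextBattery (c t ω) (ch t ω).2 (E t ω) n
  data : ∀ t ω, net.DataLinkControl α (U t ω) (E t ω) (ch t ω).1 (c t ω)
  energy : ∀ t ω, net.EnergyLinkControl α V (U t ω) (E t ω) (ch t ω).2 (c t ω)

/-! ### The constants of the performance bounds -/

/-- The largest number `Nₒ` of links going out of a node. -/
def maxOut (net : WPCN 𝕜 N S L M) : ℕ :=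
  Finset.univ.sup fun n => (Finset.univ.filter fun l => net.tx l = n).card

/-- The largest number `Nᵢ` of links coming into a node. -/
def maxIn (net : WPCN 𝕜 N S L M) : ℕ :=
  Finset.univ.sup fun n => (Finset.univ.filter fun l => net.rx l = n).card

/-- The constant `B₀`. -/
def boundB0 (net : WPCN 𝕜 N S L M) (α : ℝ) : ℝ :=
  (net.threshold α + net.Am + net.maxIn * net.Cm) ^ 2

/-- The constant `B₁`. -/
def boundB1 (net : WPCN 𝕜 N S L M) (α : ℝ) : ℝ :=
  1 / 2 * ((net.maxOut : ℝ) ^ 2 + (net.maxIn : ℝ) ^ 2) * net.Cm ^ 2 + 1 / 2 * net.Am ^ 2 +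
    net.Am * net.maxIn * net.Cm +
    1 / 2 * (net.Am + net.maxIn * net.Cm + net.energyFactor α * net.maxOut * net.Pm) ^ 2

/-- The constant `B₂`. -/
def boundB2 (net : WPCN 𝕜 N S L M) (α : ℝ) : ℝ :=
  ((net.maxOut : ℝ) ^ 2 + (net.maxIn : ℝ) ^ 2) * net.Cm ^ 2 + net.Am ^ 2 +
    2 * net.Am * net.maxIn * net.Cm +
    1 / 2 * net.energyFactor α ^ 2 * (net.maxOut : ℝ) ^ 2 * net.Pm ^ 2 +
    1 / 2 * net.energyFactor α ^ 2 * net.PAPm ^ 2 +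
    net.energyFactor α * net.PAPm * net.maxOut * net.Cm +
    net.energyFactor α * net.maxOut * net.maxIn * net.Pm * net.Cm +
    net.energyFactor α * net.Am * net.maxOut * net.Pm

/-- The constant `B = N S max {B₀, B₁, B₂}`. -/
def boundB (net : WPCN 𝕜 N S L M) (α : ℝ) : ℝ :=
  N * S * max (net.boundB0 α) (max (net.boundB1 α) (net.boundB2 α))

end WPCN

end

/-! The proof is a Lyapunov drift-plus-penalty argument, with weights designed so that batteries
need no separate constraint.

Batteries. If link `l` out of `n` transmits, optimality against switching it off forces `J_n ≤ δ
W_l`: the power saved costs `J_n p_l`, the data lost are worth at most `W_l δ p_l`, and the other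
links only gain. If moreover `E_n ≤ P_m`, the queue served is critical, and the inequality becomes
`𝒞(U - 𝒞E) ≤ δ(2U - 𝒞E)`. The choice of `𝒞` turns this into `U ≤ (𝒞 + αδ)E ≤ U₀`, contradicting
congestion. So a transmitting node always holds more than `P_m` (`DataLinkControl.lt_battery`), and
batteries stay nonnegative.

Drift. The Lyapunov function is half the sum of squares of the excesses `U - 𝒞E` of critical queues
and of the backlogs of congested queues. Its change in one slot is at most `B` plus a form linear in
the decision, with weights `π` and `J` (`lyapunov_drift_le`); the constants `B₀`, `B₁`, `B₂` belong
to queues that are uncongested, congested but not critical, and critical. With `V p_AP` added, the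
decision-dependent part is `cost`, and the policy minimizes it over all feasible decisions
(`cost_le_of_policy`). For the beamformer this is the Rayleigh principle.

Comparison. No optimal stationary policy is constructed. The policy is compared directly with any
slot of any stabilizing process. Since the current weights are independent of the current channel,
averaging the pointwise inequality over the competitor's conditional law given its channel replaces
weights and decision terms by their means (`integral_le_sum_integral_mul_integral`). Averaging over
the competitor's first `T` slots, for suitable large `T`, stability makes its mean net inflow at
most `-r` and its energy deficit at most `0`, up to small errors (`StabilizableWith.integral_le`).

Telescoping with `r = λ` bounds the power. With `r = λ + ε_max` it leaves a term `-ε_max ∑ E π`,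
which bounds the backlog because `U ≤ π + U₀`. -/

noncomputable section
namespace WPCN

variable {𝕜 : Type} [RCLike 𝕜] {N S L M : ℕ}

/-! ### Elementary properties of the model -/

lemma energyFactor_pos (net : WPCN 𝕜 N S L M) {α : ℝ} (hα : 1 < α) : 0 < net.energyFactor α := by
  have h : 1 / α < 1 := by rw [div_lt_one (by linarith)]; exact hα
  exact div_pos (by linarith [net.δ_pos]) (by linarith)

/-- The identity for which `𝒞` is chosen: equivalently `𝒞 - 2δ = 𝒞/α`. -/
lemma energyFactor_mul (net : WPCN 𝕜 N S L M) {α : ℝ} (hα : 1 < α) :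
    net.energyFactor α * (α - 1) = 2 * net.δ * α := by
  have h0 : α ≠ 0 := by linarith
  have h1 : α - 1 ≠ 0 := by linarith
  have h : 1 - 1 / α = (α - 1) / α := by field_simp
  rw [energyFactor, h]
  field_simp

lemma threshold_pos (net : WPCN 𝕜 N S L M) {α : ℝ} (hα : 1 < α) : 0 < net.threshold α := by
  have := net.energyFactor_pos hα
  have := net.δ_pos
  have := net.Pm_pos
  unfold threshold
  positivity

lemma cap_eq_zero (net : WPCN 𝕜 N S L M) {p : Fin L → ℝ} (hp : p ∈ net.feasible)
    (g : Fin L → 𝕜) {l : Fin L} (hl : p l = 0) : net.cap p g l = 0 := by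
  have h1 := net.cap_le_linear p hp g l
  rw [hl, mul_zero] at h1
  exact le_antisymm h1 (net.cap_nonneg p hp g l)

/-- Any set of links can be switched off without harming the other links. -/
lemma exists_switchOff (net : WPCN 𝕜 N S L M) {p : Fin L → ℝ} (hp : p ∈ net.feasible)
    (g : Fin L → 𝕜) (s : Finset (Fin L)) :
    ∃ q ∈ net.feasible, (∀ l ∈ s, q l = 0) ∧ (∀ l, q l ≤ p l) ∧
      ∀ l ∉ s, net.cap p g l ≤ net.cap q g l := by
  induction s using Finset.induction_on with
  | empty => exact ⟨p, hp, by simp, fun l => le_rfl, fun l _ => le_rfl⟩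
  | insert a s _ ih =>
    obtain ⟨q, hq, h0, hle, hcap⟩ := ih
    refine ⟨Function.update q a 0, net.switchOff_mem q hq a, ?_, ?_, ?_⟩
    · intro l hl
      by_cases h : l = a
      · simp [h]
      · rw [Function.update_of_ne h]
        exact h0 l (Finset.mem_of_mem_insert_of_ne hl h)
    · intro l
      by_cases h : l = a
      · subst h
        simpa using net.power_nonneg p hp l
      · rw [Function.update_of_ne h]
        exact hle l
    · intro l hl
      rw [Finset.mem_insert, not_or] at hl
      exact (hcap l hl.2).trans (net.interference q hq g a l hl.1)

lemma sum_mul_sum_fiber {ι κ : Type*} [Fintype ι] [Fintype κ] [DecidableEq κ] (f : ι → κ)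
    (a : κ → ℝ) (b : ι → ℝ) :
    ∑ k, a k * ∑ i with f i = k, b i = ∑ i, a (f i) * b i := by
  simp_rw [Finset.mul_sum, Finset.sum_filter]
  rw [Finset.sum_comm]
  simp

/-- Amount of data of stream `s` that node `n` can send. -/
def outflow (net : WPCN 𝕜 N S L M) (c : Control 𝕜 S L M) (n : Fin N) (s : Fin S) : ℝ :=
  ∑ l with net.tx l = n, c.C l s

/-- Amount of data of stream `s` that node `n` can receive. -/
def inflow (net : WPCN 𝕜 N S L M) (c : Control 𝕜 S L M) (n : Fin N) (s : Fin S) : ℝ :=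
  ∑ l with net.rx l = n, c.C l s

namespace IsFeasible

variable {net : WPCN 𝕜 N S L M} {g : Fin L → 𝕜} {c : Control 𝕜 S L M}

lemma rate_le_cap (hc : net.IsFeasible g c) (l : Fin L) (s : Fin S) :
    c.C l s ≤ net.cap c.p g l :=
  (Finset.single_le_sum (f := fun s => c.C l s) (fun s _ => hc.rate_nonneg l s)
    (Finset.mem_univ s)).trans (hc.rate_le l)

lemma outflow_nonneg (hc : net.IsFeasible g c) (n : Fin N) (s : Fin S) : 0 ≤ net.outflow c n s :=
  Finset.sum_nonneg fun l _ => hc.rate_nonneg l s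

lemma inflow_nonneg (hc : net.IsFeasible g c) (n : Fin N) (s : Fin S) : 0 ≤ net.inflow c n s :=
  Finset.sum_nonneg fun l _ => hc.rate_nonneg l s

lemma rate_le_Cm (hc : net.IsFeasible g c) (l : Fin L) (s : Fin S) : c.C l s ≤ net.Cm :=
  (hc.rate_le_cap l s).trans (net.cap_le _ hc.power g l)

lemma outflow_le (hc : net.IsFeasible g c) (n : Fin N) (s : Fin S) :
    net.outflow c n s ≤ net.maxOut * net.Cm := by
  refine (Finset.sum_le_card_nsmul _ _ net.Cm fun l _ => hc.rate_le_Cm l s).trans ?_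
  rw [nsmul_eq_mul]
  refine mul_le_mul_of_nonneg_right ?_ net.Cm_pos.le
  exact_mod_cast Finset.le_sup (f := fun n => (Finset.univ.filter fun l => net.tx l = n).card)
    (Finset.mem_univ n)

lemma inflow_le (hc : net.IsFeasible g c) (n : Fin N) (s : Fin S) :
    net.inflow c n s ≤ net.maxIn * net.Cm := by
  refine (Finset.sum_le_card_nsmul _ _ net.Cm fun l _ => hc.rate_le_Cm l s).trans ?_
  rw [nsmul_eq_mul]
  refine mul_le_mul_of_nonneg_right ?_ net.Cm_pos.le
  exact_mod_cast Finset.le_sup (f := fun n => (Finset.univ.filter fun l => net.rx l = n).card)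
    (Finset.mem_univ n)

lemma spent_nonneg (hc : net.IsFeasible g c) (n : Fin N) : 0 ≤ net.spent c n :=
  Finset.sum_nonneg fun l _ => net.power_nonneg _ hc.power l

lemma spent_le_Pm (hc : net.IsFeasible g c) (n : Fin N) : net.spent c n ≤ net.Pm :=
  net.power_le _ hc.power n

lemma spent_le (hc : net.IsFeasible g c) (n : Fin N) :
    net.spent c n ≤ net.maxOut * net.Pm := by
  have hcard := Finset.le_sup (f := fun n => (Finset.univ.filter fun l => net.tx l = n).card)
    (Finset.mem_univ n)
  refine (Finset.sum_le_card_nsmul _ _ net.Pm fun l hl => ?_).trans ?_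
  · rw [Finset.mem_filter] at hl
    refine (Finset.single_le_sum (f := fun l => c.p l) (s := {l | net.tx l = n})
      (fun l _ => net.power_nonneg _ hc.power l) ?_).trans (net.power_le _ hc.power n)
    simp [hl.2]
  · rw [nsmul_eq_mul]
    refine mul_le_mul_of_nonneg_right ?_ net.Pm_pos.le
    exact_mod_cast hcard

/-- Together with `δ P_m ≤ U₀`, this keeps a congested queue from being emptied within one slot, so
that the truncation at zero is inactive. -/
lemma outflow_le_linear (hc : net.IsFeasible g c) (n : Fin N) (s : Fin S) :
    net.outflow c n s ≤ net.δ * net.Pm := by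
  refine le_trans ?_ (mul_le_mul_of_nonneg_left (hc.spent_le_Pm n) net.δ_pos.le)
  rw [spent, Finset.mul_sum]
  exact Finset.sum_le_sum fun l _ =>
    (hc.rate_le_cap l s).trans (net.cap_le_linear _ hc.power g l)

lemma received_nonneg (hc : net.IsFeasible g c) (h : Fin N → Fin M → 𝕜) (n : Fin N) :
    0 ≤ received c h n :=
  mul_nonneg hc.pAP_nonneg (sq_nonneg _)

end IsFeasible

lemma norm_sum_mul_sq_le (v w : Fin M → 𝕜) :
    ‖∑ m, w m * v m‖ ^ 2 ≤ (∑ m, ‖w m‖ ^ 2) * ∑ m, ‖v m‖ ^ 2 := by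
  have h1 : ‖∑ m, w m * v m‖ ≤ ∑ m, ‖w m‖ * ‖v m‖ :=
    (norm_sum_le _ _).trans_eq (by simp)
  exact (pow_le_pow_left₀ (norm_nonneg _) h1 2).trans (Finset.sum_mul_sq_le_sq_mul_sq _ _ _)

lemma IsFeasible.received_le {net : WPCN 𝕜 N S L M} {g : Fin L → 𝕜} {c : Control 𝕜 S L M}
    (hc : net.IsFeasible g c) {h : Fin N → Fin M → 𝕜} {n : Fin N}
    (hh : ∑ m, ‖h n m‖ ^ 2 ≤ 1) : received c h n ≤ net.PAPm := by
  have h1 : beamGain c.w h n ≤ 1 := by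
    refine (norm_sum_mul_sq_le (h n) c.w).trans ?_
    rw [hc.beam, one_mul]
    exact hh
  calc received c h n ≤ c.pAP * 1 := mul_le_mul_of_nonneg_left h1 hc.pAP_nonneg
    _ ≤ net.PAPm := by rw [mul_one]; exact hc.pAP_le

/-! ### The coefficients of the policy -/

open Classical in
/-- The excess `U n s - 𝒞 E n` of a critically congested queue. -/
def excess (net : WPCN 𝕜 N S L M) (α : ℝ) (U : Fin N → Fin S → ℝ) (E : Fin N → ℝ)
    (n : Fin N) (s : Fin S) : ℝ :=
  if net.Critical α U E n s then U n s - net.energyFactor α * E n else 0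

open Classical in
/-- The backlog of a congested queue. -/
def congestedBacklog (net : WPCN 𝕜 N S L M) (α : ℝ) (U : Fin N → Fin S → ℝ)
    (n : Fin N) (s : Fin S) : ℝ :=
  if net.Congested α U n s then U n s else 0

section coefficients

variable (net : WPCN 𝕜 N S L M) {α : ℝ} (U : Fin N → Fin S → ℝ) (E : Fin N → ℝ)

lemma pressure_eq (n : Fin N) (s : Fin S) :
    net.pressure α U E n s = net.excess α U E n s + net.congestedBacklog α U n s := rfl

lemma powerCoeff_eq (n : Fin N) :
    net.powerCoeff α U E n = net.energyFactor α * ∑ s, net.excess α U E n s := rfl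

lemma excess_nonneg (n : Fin N) (s : Fin S) : 0 ≤ net.excess α U E n s := by
  unfold excess
  split_ifs with h
  · have := (le_max_right _ _).trans_lt h
    linarith
  · exact le_rfl

lemma congestedBacklog_nonneg (hα : 1 < α) (n : Fin N) (s : Fin S) :
    0 ≤ net.congestedBacklog α U n s := by
  unfold congestedBacklog
  split_ifs with h
  · exact ((net.threshold_pos hα).trans h).le
  · exact le_rfl

lemma pressure_nonneg (hα : 1 < α) (n : Fin N) (s : Fin S) : 0 ≤ net.pressure α U E n s :=
  add_nonneg (net.excess_nonneg U E n s) (net.congestedBacklog_nonneg U hα n s)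

lemma powerCoeff_nonneg (hα : 1 < α) (n : Fin N) : 0 ≤ net.powerCoeff α U E n :=
  mul_nonneg (net.energyFactor_pos hα).le (Finset.sum_nonneg fun s _ => net.excess_nonneg U E n s)

variable {U E}

lemma excess_le (hα : 1 < α) (hU : ∀ n s, 0 ≤ U n s) (hE : ∀ n, 0 ≤ E n) (n : Fin N)
    (s : Fin S) : net.excess α U E n s ≤ U n s := by
  have := mul_nonneg (net.energyFactor_pos hα).le (hE n)
  have := hU n s
  unfold excess
  split_ifs <;> linarith

lemma congestedBacklog_le (hU : ∀ n s, 0 ≤ U n s) (n : Fin N) (s : Fin S) :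
    net.congestedBacklog α U n s ≤ U n s := by
  unfold congestedBacklog
  split_ifs
  · exact le_rfl
  · exact hU n s

/-- The indicators lose at most `U₀` per queue; this is what turns a bound on the weights into a
bound on the backlogs and produces the extra term of `B'`. -/
lemma le_congestedBacklog_add (hα : 1 < α) (n : Fin N) (s : Fin S) :
    U n s ≤ net.congestedBacklog α U n s + net.threshold α := by
  have := net.threshold_pos hα
  unfold congestedBacklog
  split_ifs with h
  · linarith
  · rw [Congested, not_lt] at h
    linarith

lemma pressure_le (hα : 1 < α) (hU : ∀ n s, 0 ≤ U n s) (hE : ∀ n, 0 ≤ E n) (n : Fin N)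
    (s : Fin S) : net.pressure α U E n s ≤ 2 * U n s := by
  rw [pressure_eq]
  linarith [net.excess_le hα hU hE n s, net.congestedBacklog_le (α := α) hU n s]

lemma congested_of_critical {n : Fin N} {s : Fin S} (h : net.Critical α U E n s) :
    net.Congested α U n s :=
  (le_max_left _ _).trans_lt h

end coefficients

/-! ### Batteries are never overdrawn -/

/-- The minimizer is compared with the vector obtained by switching `l` off. The linear bound on the
capacity makes the comparison linear in `p_l`, which then cancels. -/
lemma DataLinkControl.powerCoeff_le {net : WPCN 𝕜 N S L M} {α : ℝ} {U : Fin N → Fin S → ℝ}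
    {E : Fin N → ℝ} {g : Fin L → 𝕜} {c : Control 𝕜 S L M}
    (h : net.DataLinkControl α U E g c) {l : Fin L} (hl : c.p l ≠ 0) :
    ∃ s, 0 < net.dataCoeff α U E l s ∧
      net.powerCoeff α U E (net.tx l) ≤ net.δ * net.dataCoeff α U E l s := by
  obtain ⟨σ, -, hp, hmin, hoff, -⟩ := h
  have hW : 0 < net.dataCoeff α U E l (σ l) := by
    by_contra hW
    exact hl (hoff l (not_lt.1 hW))
  refine ⟨σ l, hW, ?_⟩
  have hpl : 0 < c.p l := lt_of_le_of_ne (net.power_nonneg _ hp l) hl.symm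
  set W : Fin L → ℝ := fun l => net.dataCoeff α U E l (σ l) with hWdef
  set J := net.powerCoeff α U E
  have h1 := hmin _ (net.switchOff_mem _ hp l)
  unfold linkObjective at h1
  rw [← Finset.add_sum_erase _ _ (Finset.mem_univ l),
    ← Finset.add_sum_erase (a := l) Finset.univ _ (Finset.mem_univ l)] at h1
  have h2 : ∑ l' ∈ Finset.univ.erase l, (J (net.tx l') * Function.update c.p l 0 l' -
      W l' * net.cap (Function.update c.p l 0) g l') ≤
      ∑ l' ∈ Finset.univ.erase l, (J (net.tx l') * c.p l' - W l' * net.cap c.p g l') := by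
    refine Finset.sum_le_sum fun l' hl' => ?_
    have hne := Finset.ne_of_mem_erase hl'
    rw [Function.update_of_ne hne]
    -- With a negative weight, extra capacity would hurt the objective. The tie-breaking rule
    -- excludes this: such a link has no power, hence no capacity, before and after the change.
    by_cases hWl : W l' ≤ 0
    · have h0 : c.p l' = 0 := hoff l' hWl
      have h0' : Function.update c.p l 0 l' = 0 := by rw [Function.update_of_ne hne, h0]
      rw [net.cap_eq_zero hp g h0, net.cap_eq_zero (net.switchOff_mem _ hp l) g h0']
    · have := mul_le_mul_of_nonneg_left (net.interference _ hp g l l' hne) (not_le.1 hWl).le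
      linarith
  rw [net.cap_switchOff _ hp g l, Function.update_self] at h1
  have h3 : W l * net.cap c.p g l ≤ W l * (net.δ * c.p l) :=
    mul_le_mul_of_nonneg_left (net.cap_le_linear _ hp g l) hW.le
  have h4 : J (net.tx l) * c.p l ≤ (net.δ * W l) * c.p l := by nlinarith
  exact le_of_mul_le_mul_right h4 hpl

/-- With a battery level of at most `P_m`, the energy price `J` outweighs the value of any data sent
from a congested queue; `U₀` is exactly the backlog at which this contradiction appears. -/
lemma DataLinkControl.lt_battery {net : WPCN 𝕜 N S L M} {α : ℝ} (hα : 1 < α)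
    {U : Fin N → Fin S → ℝ} {E : Fin N → ℝ} {g : Fin L → 𝕜} {c : Control 𝕜 S L M}
    (h : net.DataLinkControl α U E g c) {l : Fin L} (hl : c.p l ≠ 0) :
    net.Pm < E (net.tx l) := by
  by_contra hE
  rw [not_lt] at hE
  obtain ⟨s, hs, hJ⟩ := h.powerCoeff_le hl
  set n := net.tx l
  have hC := net.energyFactor_pos hα
  have hCα := net.energyFactor_mul hα
  have hδ := net.δ_pos
  have hPm := net.Pm_pos
  have hπ : 0 < net.pressure α U E n s := by
    have := net.pressure_nonneg U E hα (net.rx l) s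
    unfold dataCoeff at hs
    linarith
  have hcong : net.Congested α U n s := by
    by_contra hcong
    have hcrit : ¬ net.Critical α U E n s := fun h => hcong (net.congested_of_critical h)
    simp [pressure, hcong, hcrit] at hπ
  -- A congested queue at a node with `E ≤ P_m` is critical, since `U₀ > 𝒞 P_m ≥ 𝒞 E`.
  have hcrit : net.Critical α U E n s := by
    refine max_lt hcong (lt_of_le_of_lt ?_ hcong)
    unfold threshold
    have := mul_le_mul_of_nonneg_left hE hC.le
    have : 0 < net.Pm * (α * net.δ) := by positivity
    linarith
  have h1 : net.excess α U E n s = U n s - net.energyFactor α * E n := if_pos hcrit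
  have h2 : net.pressure α U E n s = 2 * U n s - net.energyFactor α * E n := by
    rw [pressure_eq, h1, congestedBacklog, if_pos hcong]
    ring
  have h3 : net.energyFactor α * (U n s - net.energyFactor α * E n) ≤ net.powerCoeff α U E n := by
    rw [powerCoeff_eq, ← h1]
    exact mul_le_mul_of_nonneg_left (Finset.single_le_sum
      (f := fun s => net.excess α U E n s) (fun s _ => net.excess_nonneg U E n s)
      (Finset.mem_univ s)) hC.le
  have h4 : net.dataCoeff α U E l s ≤ net.pressure α U E n s := by
    have := net.pressure_nonneg U E hα (net.rx l) s
    unfold dataCoeff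
    linarith
  have h5 := mul_le_mul_of_nonneg_left h4 hδ.le
  have h6 : net.threshold α < U n s := hcong
  unfold threshold at h6
  rw [h2] at h5
  set 𝒞 := net.energyFactor α
  have hkey : 𝒞 * (U n s - 𝒞 * E n) ≤ net.δ * (2 * U n s - 𝒞 * E n) := by linarith
  -- This is `hkey` multiplied by `α` and sorted by `U` and `E`. The coefficient of `U` equals `𝒞`,
  -- which cancels against the right side.
  have h7 : (𝒞 * α - 2 * net.δ * α) * U n s ≤ α * (𝒞 - net.δ) * (𝒞 * E n) := by nlinarith
  rw [show 𝒞 * α - 2 * net.δ * α = 𝒞 by linarith] at h7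
  have h8 : U n s ≤ α * (𝒞 - net.δ) * E n := by
    refine le_of_mul_le_mul_left ?_ hC
    linarith
  have h9 : net.δ < 𝒞 := by
    by_contra h9
    nlinarith [mul_le_mul_of_nonneg_right (not_lt.1 h9) (by linarith : (0:ℝ) ≤ α - 1)]
  have h10 : α * (𝒞 - net.δ) * E n ≤ α * (𝒞 - net.δ) * net.Pm :=
    mul_le_mul_of_nonneg_left hE (mul_nonneg (by linarith) (by linarith))
  have h11 : α * (𝒞 - net.δ) = 𝒞 + α * net.δ := by linarith
  rw [h11] at h10 h8
  linarith

/-- Either some link of the node is active, and the battery exceeds the peak power `P_m`, or nothing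
is spent. -/
lemma DataLinkControl.spent_le_battery {net : WPCN 𝕜 N S L M} {α : ℝ} (hα : 1 < α)
    {U : Fin N → Fin S → ℝ} {E : Fin N → ℝ} {g : Fin L → 𝕜} {c : Control 𝕜 S L M}
    (h : net.DataLinkControl α U E g c) {n : Fin N} (hE : 0 ≤ E n) : net.spent c n ≤ E n := by
  by_cases hex : ∃ l, net.tx l = n ∧ c.p l ≠ 0
  · obtain ⟨l, rfl, hl⟩ := hex
    have h1 := h.lt_battery hα hl
    obtain ⟨σ, -, hp, -⟩ := h
    exact (net.power_le _ hp _).trans h1.le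
  · push Not at hex
    unfold spent
    rw [Finset.sum_eq_zero]
    · exact hE
    · intro l hl
      exact hex l (Finset.mem_filter.1 hl).2

end WPCN

namespace WPCN

variable {𝕜 : Type} [RCLike 𝕜] {N S L M : ℕ}

/-! ### Beamforming along a leading eigenvector is optimal -/

lemma star_dotProduct_vecMul_sumChannel (J : Fin N → ℝ) (h : Fin N → Fin M → 𝕜)
    (v : Fin M → 𝕜) :
    star v ⬝ᵥ Matrix.vecMul v (sumChannel J h) =
      ((∑ n, beamGain v h n * J n : ℝ) : 𝕜) := by
  have h1 : Matrix.vecMul v (sumChannel J h) =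
      ∑ n, ((J n : 𝕜) * (v ⬝ᵥ h n)) • star (h n) := by
    rw [sumChannel, Matrix.vecMul_sum]
    refine Finset.sum_congr rfl fun n _ => ?_
    rw [Matrix.vecMul_smul, Matrix.vecMul_vecMulVec, smul_smul]
  rw [h1, dotProduct_sum]
  push_cast
  refine Finset.sum_congr rfl fun n _ => ?_
  have h2 : star v ⬝ᵥ star (h n) = star (v ⬝ᵥ h n) := by
    simp [dotProduct, mul_comm]
  rw [dotProduct_smul, h2, smul_eq_mul, mul_assoc, RCLike.star_def, RCLike.mul_conj, beamGain,
    mul_comm]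
  simp [dotProduct]

lemma isHermitian_sumChannel (J : Fin N → ℝ) (h : Fin N → Fin M → 𝕜) :
    (sumChannel J h).IsHermitian := by
  ext i j
  simp [sumChannel, Matrix.sum_apply, Matrix.vecMulVec_apply, mul_comm]

lemma star_dotProduct_self (v : Fin M → 𝕜) : star v ⬝ᵥ v = ((∑ m, ‖v m‖ ^ 2 : ℝ) : 𝕜) := by
  simp [dotProduct, RCLike.conj_mul]

/-- The quadratic form of a Hermitian matrix is bounded by any upper bound of its eigenvalues. -/
lemma re_star_dotProduct_vecMul_le {H : Matrix (Fin M) (Fin M) 𝕜} (hH : H.IsHermitian) {a : ℝ}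
    (ha : ∀ (b : ℝ) (v : Fin M → 𝕜), v ≠ 0 → Matrix.vecMul v H = (b : 𝕜) • v → b ≤ a)
    {v : Fin M → 𝕜} (hv : ∑ m, ‖v m‖ ^ 2 = 1) :
    RCLike.re (star v ⬝ᵥ Matrix.vecMul v H) ≤ a := by
  -- The transpose appears because the eigenvectors are row vectors: `v H` is `Hᵀ` applied to `v`.
  set T : EuclideanSpace 𝕜 (Fin M) →ₗ[𝕜] EuclideanSpace 𝕜 (Fin M) := Matrix.toEuclideanLin H.transpose
    with hTdef
  have hT : T.IsSymmetric := Matrix.isSymmetric_toEuclideanLin_iff.2 hH.transpose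
  have hTapp : ∀ x : EuclideanSpace 𝕜 (Fin M),
      T x = WithLp.toLp 2 (Matrix.vecMul (WithLp.ofLp x) H) := by
    intro x
    rw [hTdef, Matrix.toLpLin_apply, Matrix.mulVec_transpose]
  set x : EuclideanSpace 𝕜 (Fin M) := WithLp.toLp 2 v with hx
  have hxn : ‖x‖ = 1 := by
    rw [EuclideanSpace.norm_eq]
    simp [hx, hv]
  have hx0 : x ≠ 0 := by
    intro h
    rw [h, norm_zero] at hxn
    exact zero_ne_one hxn
  have : Nontrivial (EuclideanSpace 𝕜 (Fin M)) := ⟨⟨x, 0, hx0⟩⟩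
  -- In finite dimension the supremum of the Rayleigh quotient is itself an eigenvalue, so `a`
  -- dominates it.
  obtain ⟨y, hy⟩ := hT.hasEigenvalue_iSup_of_finiteDimensional.exists_hasEigenvector
  have hle := ha _ (WithLp.ofLp y) (by simpa using hy.2) (by
    have := hy.apply_eq_smul
    rw [hTapp] at this
    exact congrArg WithLp.ofLp this)
  refine le_trans ?_ hle
  have hbdd : BddAbove (Set.range fun z : {z : EuclideanSpace 𝕜 (Fin M) // z ≠ 0} =>
      RCLike.re (inner 𝕜 (T z) (z : EuclideanSpace 𝕜 (Fin M))) /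
        ‖(z : EuclideanSpace 𝕜 (Fin M))‖ ^ 2) := by
    refine ⟨‖T.toContinuousLinearMap‖, ?_⟩
    rintro _ ⟨⟨z, hz⟩, rfl⟩
    have hz' : 0 < ‖z‖ := norm_pos_iff.2 hz
    rw [div_le_iff₀ (by positivity)]
    calc RCLike.re (inner 𝕜 (T z) z) ≤ ‖T z‖ * ‖z‖ := re_inner_le_norm _ _
      _ ≤ (‖T.toContinuousLinearMap‖ * ‖z‖) * ‖z‖ :=
        mul_le_mul_of_nonneg_right (T.toContinuousLinearMap.le_opNorm z) hz'.le
      _ = _ := by ring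
  refine le_trans (le_of_eq ?_) (le_ciSup hbdd ⟨x, hx0⟩)
  simp only [hxn, one_pow, div_one]
  rw [hT, EuclideanSpace.inner_eq_star_dotProduct, hTapp, dotProduct_comm]

lemma IsLeadingEigenvector.sum_beamGain_le {J : Fin N → ℝ} {h : Fin N → Fin M → 𝕜}
    {w : Fin M → 𝕜} (hw : IsLeadingEigenvector (sumChannel J h) w) {v : Fin M → 𝕜}
    (hv : ∑ m, ‖v m‖ ^ 2 = 1) :
    ∑ n, beamGain v h n * J n ≤ ∑ n, beamGain w h n * J n := by
  obtain ⟨hw1, a, hwa, ha⟩ := hw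
  have h1 := re_star_dotProduct_vecMul_le (isHermitian_sumChannel J h) ha hv
  rw [star_dotProduct_vecMul_sumChannel, RCLike.ofReal_re] at h1
  have h2 := star_dotProduct_vecMul_sumChannel J h w
  rw [hwa, dotProduct_smul, star_dotProduct_self, hw1, RCLike.ofReal_one, smul_eq_mul,
    mul_one] at h2
  rw [← RCLike.ofReal_inj.1 h2]
  exact h1

/-! ### The policy minimizes the drift-plus-penalty bound -/

/-- The part of the bound on the drift plus penalty that depends on the decision, for data
weights `x`, energy weights `y` and price `V` of EAP power. -/
def cost (net : WPCN 𝕜 N S L M) (V : ℝ) (x : Fin N → Fin S → ℝ) (y : Fin N → ℝ)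
    (h : Fin N → Fin M → 𝕜) (c : Control 𝕜 S L M) : ℝ :=
  ∑ n, ∑ s, x n s * (net.inflow c n s - net.outflow c n s) +
    ∑ n, y n * (net.spent c n - received c h n) + V * c.pAP

/-- Regrouping node sums by links separates the cost into a data part, governed by link powers and
rates, and an energy part, governed by beam and EAP power. The two controls can therefore be
optimized independently. -/
lemma cost_eq (net : WPCN 𝕜 N S L M) (V : ℝ) (x : Fin N → Fin S → ℝ) (y : Fin N → ℝ)
    (h : Fin N → Fin M → 𝕜) (c : Control 𝕜 S L M) :
    net.cost V x y h c = ∑ l, (y (net.tx l) * c.p l -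
        ∑ s, (x (net.tx l) s - x (net.rx l) s) * c.C l s) +
      c.pAP * (V - ∑ n, beamGain c.w h n * y n) := by
  have h1 : ∑ n, ∑ s, x n s * (net.inflow c n s - net.outflow c n s) =
      ∑ l, ∑ s, (x (net.rx l) s - x (net.tx l) s) * c.C l s := by
    rw [Finset.sum_comm, Finset.sum_comm (s := (Finset.univ : Finset (Fin L)))]
    refine Finset.sum_congr rfl fun s _ => ?_
    simp_rw [mul_sub, sub_mul, Finset.sum_sub_distrib, inflow, outflow]
    rw [sum_mul_sum_fiber net.rx (fun n => x n s), sum_mul_sum_fiber net.tx (fun n => x n s)]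
  have h2 : ∑ n, y n * net.spent c n = ∑ l, y (net.tx l) * c.p l :=
    sum_mul_sum_fiber net.tx y c.p
  have h3 : ∑ n, y n * received c h n = c.pAP * ∑ n, beamGain c.w h n * y n := by
    rw [Finset.mul_sum]
    refine Finset.sum_congr rfl fun n _ => ?_
    unfold received
    ring
  have h4 : ∑ l, ∑ s, (x (net.rx l) s - x (net.tx l) s) * c.C l s =
      - ∑ l, ∑ s, (x (net.tx l) s - x (net.rx l) s) * c.C l s := by
    simp_rw [← Finset.sum_neg_distrib]
    refine Finset.sum_congr rfl fun l _ => Finset.sum_congr rfl fun s _ => by ring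
  unfold cost
  simp_rw [mul_sub, Finset.sum_sub_distrib] at *
  rw [h2, h3, h1, h4]
  ring

/-- Serving one stream of maximal coefficient dominates any split of the capacity, provided the
coefficient is positive. -/
lemma DataLinkControl.optimal {net : WPCN 𝕜 N S L M} {α : ℝ} (hα : 1 < α)
    {U : Fin N → Fin S → ℝ} {E : Fin N → ℝ} {g : Fin L → 𝕜} {c c' : Control 𝕜 S L M}
    (h : net.DataLinkControl α U E g c) (hc' : net.IsFeasible g c') :
    ∑ l, (net.powerCoeff α U E (net.tx l) * c.p l - ∑ s, net.dataCoeff α U E l s * c.C l s) ≤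
      ∑ l, (net.powerCoeff α U E (net.tx l) * c'.p l -
        ∑ s, net.dataCoeff α U E l s * c'.C l s) := by
  obtain ⟨σ, hσ, hp, hmin, -, hC⟩ := h
  -- The link objective charges full capacity even where `W ≤ 0`, whereas `c'` may leave such
  -- capacity idle. Hence `c'.p` is replaced by a vector with these links off, which uses no more
  -- power and does not harm the remaining links.
  obtain ⟨q, hq, hq0, hqle, hqcap⟩ := net.exists_switchOff hc'.power g
    {l | net.dataCoeff α U E l (σ l) ≤ 0}
  refine le_trans (le_of_eq ?_) ((hmin q hq).trans ?_)
  · unfold linkObjective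
    refine Finset.sum_congr rfl fun l _ => ?_
    simp [hC]
  · unfold linkObjective
    refine Finset.sum_le_sum fun l _ => ?_
    refine sub_le_sub (mul_le_mul_of_nonneg_left (hqle l) (net.powerCoeff_nonneg U E hα _)) ?_
    have h1 : ∑ s, net.dataCoeff α U E l s * c'.C l s ≤
        net.dataCoeff α U E l (σ l) * ∑ s, c'.C l s := by
      rw [Finset.mul_sum]
      exact Finset.sum_le_sum fun s _ =>
        mul_le_mul_of_nonneg_right (hσ l s) (hc'.rate_nonneg l s)
    refine h1.trans ?_
    by_cases hW : net.dataCoeff α U E l (σ l) ≤ 0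
    · rw [net.cap_eq_zero hq g (hq0 l (by simpa using hW)), mul_zero]
      exact mul_nonpos_of_nonpos_of_nonneg hW
        (Finset.sum_nonneg fun s _ => hc'.rate_nonneg l s)
    · exact mul_le_mul_of_nonneg_left
        ((hc'.rate_le l).trans (hqcap l (by simpa using hW))) (not_le.1 hW).le

/-- For a fixed EAP power the leading eigenvector is the best beam. What remains is linear in the
EAP power, so an endpoint of `[0, P_APm]` is optimal. -/
lemma EnergyLinkControl.optimal {net : WPCN 𝕜 N S L M} {α V : ℝ}
    {U : Fin N → Fin S → ℝ} {E : Fin N → ℝ} {g : Fin L → 𝕜} {h : Fin N → Fin M → 𝕜}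
    {c c' : Control 𝕜 S L M} (he : net.EnergyLinkControl α V U E h c)
    (hc' : net.IsFeasible g c') :
    c.pAP * (V - ∑ n, beamGain c.w h n * net.powerCoeff α U E n) ≤
      c'.pAP * (V - ∑ n, beamGain c'.w h n * net.powerCoeff α U E n) := by
  obtain ⟨hw, hpAP⟩ := he
  have h1 := hw.sum_beamGain_le hc'.beam
  have h0 := hc'.pAP_nonneg
  have h2 := hc'.pAP_le
  set X := ∑ n, beamGain c.w h n * net.powerCoeff α U E n
  set X' := ∑ n, beamGain c'.w h n * net.powerCoeff α U E n
  refine le_trans ?_ (mul_le_mul_of_nonneg_left (sub_le_sub_left h1 V) h0)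
  rw [hpAP]
  split_ifs with hVX
  · exact mul_le_mul_of_nonpos_right h2 (by linarith)
  · rw [zero_mul]
    exact mul_nonneg h0 (by linarith)

lemma cost_le_of_policy {net : WPCN 𝕜 N S L M} {α V : ℝ} (hα : 1 < α)
    {U : Fin N → Fin S → ℝ} {E : Fin N → ℝ} {x : ChannelState 𝕜 N L M}
    {c c' : Control 𝕜 S L M} (hd : net.DataLinkControl α U E x.1 c)
    (he : net.EnergyLinkControl α V U E x.2 c) (hc' : net.IsFeasible x.1 c') :
    net.cost V (net.pressure α U E) (net.powerCoeff α U E) x.2 c ≤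
      net.cost V (net.pressure α U E) (net.powerCoeff α U E) x.2 c' := by
  rw [cost_eq, cost_eq]
  exact add_le_add (hd.optimal hα hc') (he.optimal hc')

/-! ### The drift of the Lyapunov function -/

/-- The Lyapunov function of a single queue. -/
def queueLyapunov (net : WPCN 𝕜 N S L M) (α : ℝ) (U : Fin N → Fin S → ℝ) (E : Fin N → ℝ)
    (n : Fin N) (s : Fin S) : ℝ :=
  1 / 2 * net.excess α U E n s ^ 2 + 1 / 2 * net.congestedBacklog α U n s ^ 2

/-- The Lyapunov function. -/
def lyapunov (net : WPCN 𝕜 N S L M) (α : ℝ) (U : Fin N → Fin S → ℝ) (E : Fin N → ℝ) : ℝ :=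
  ∑ n, ∑ s, net.queueLyapunov α U E n s

lemma lyapunov_nonneg (net : WPCN 𝕜 N S L M) (α : ℝ) (U : Fin N → Fin S → ℝ) (E : Fin N → ℝ) :
    0 ≤ net.lyapunov α U E :=
  Finset.sum_nonneg fun n _ => Finset.sum_nonneg fun s _ => by
    unfold queueLyapunov
    positivity

lemma queueLyapunov_le (net : WPCN 𝕜 N S L M) {α : ℝ} (hα : 1 < α)
    {U : Fin N → Fin S → ℝ} {E : Fin N → ℝ} (hU : ∀ n s, 0 ≤ U n s) (hE : ∀ n, 0 ≤ E n)
    (n : Fin N) (s : Fin S) : net.queueLyapunov α U E n s ≤ U n s ^ 2 := by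
  have h1 := pow_le_pow_left₀ (net.excess_nonneg U E n s) (net.excess_le hα hU hE n s) 2
  have h2 := pow_le_pow_left₀ (net.congestedBacklog_nonneg U hα n s)
    (net.congestedBacklog_le (α := α) hU n s) 2
  unfold queueLyapunov
  linarith

/-- Three cases according to the state before the slot. An uncongested queue has zero weights, and
its new value is at most `U'² ≤ B₀`. A congested, noncritical one can acquire only a bounded excess.
A critical one obeys the usual quadratic expansion. The queue update enters as an inequality so that
destinations, whose queues are reset to zero, are covered too. -/
lemma queueLyapunov_drift_le (net : WPCN 𝕜 N S L M) {α : ℝ} (hα : 1 < α)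
    {U U' : Fin N → Fin S → ℝ} {E E' : Fin N → ℝ}
    (hU' : ∀ n s, 0 ≤ U' n s) (hE' : ∀ n, 0 ≤ E' n)
    {n : Fin N} {s : Fin S} {a i b p q : ℝ}
    (ha : 0 ≤ a) (haA : a ≤ net.Am) (hi : 0 ≤ i) (hiC : i ≤ net.maxIn * net.Cm)
    (hb : 0 ≤ b) (hbC : b ≤ net.maxOut * net.Cm) (hbδ : b ≤ net.δ * net.Pm)
    (hp : 0 ≤ p) (hpP : p ≤ net.maxOut * net.Pm) (hq : 0 ≤ q) (hqP : q ≤ net.PAPm)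
    (hstep : U' n s ≤ max (U n s - b) 0 + i + a) (hbat : E' n = E n - p + q) :
    net.queueLyapunov α U' E' n s ≤ net.queueLyapunov α U E n s +
      max (net.boundB0 α) (max (net.boundB1 α) (net.boundB2 α)) +
      net.pressure α U E n s * (i + a - b) +
      net.energyFactor α * net.excess α U E n s * (p - q) := by
  have hC := net.energyFactor_pos hα
  have hCm := net.Cm_pos
  have hPm := net.Pm_pos
  have hδ := net.δ_pos
  have hAm := net.Am_nonneg
  have hPAPm := net.PAPm_pos
  by_cases hcong : net.Congested α U n s
  swap
  · have hcrit : ¬ net.Critical α U E n s := fun h => hcong (net.congested_of_critical h)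
    have h1 : net.excess α U E n s = 0 := if_neg hcrit
    have h2 : net.congestedBacklog α U n s = 0 := if_neg hcong
    have h3 := net.queueLyapunov_le hα hU' hE' n s
    have h4 : max (U n s - b) 0 ≤ net.threshold α :=
      max_le (by rw [Congested, not_lt] at hcong; linarith) (net.threshold_pos hα).le
    have h5 : U' n s ^ 2 ≤ net.boundB0 α :=
      pow_le_pow_left₀ (hU' n s) (by linarith) 2
    have h6 := le_max_left (net.boundB0 α) (max (net.boundB1 α) (net.boundB2 α))
    rw [pressure_eq, queueLyapunov.eq_def net α U E n s, h1, h2]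
    linarith
  have h2 : net.congestedBacklog α U n s = U n s := if_pos hcong
  -- Since `b ≤ δ P_m ≤ U₀`, the truncation in the queue update disappears and the update becomes
  -- linear.
  have hbU : b ≤ U n s := by
    have h := hcong
    unfold Congested threshold at h
    have : 0 ≤ net.Pm * net.energyFactor α := by positivity
    have : 0 ≤ (α - 1) * (net.δ * net.Pm) := mul_nonneg (by linarith) (by positivity)
    linarith
  rw [max_eq_left (by linarith)] at hstep
  have hcong' : net.congestedBacklog α U' n s ^ 2 ≤ (U n s - b + (i + a)) ^ 2 :=
    pow_le_pow_left₀ (net.congestedBacklog_nonneg U' hα n s)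
      ((net.congestedBacklog_le hU' n s).trans (by linarith)) 2
  have hexc' : net.excess α U' E' n s = 0 ∨ net.excess α U' E' n s =
      U' n s - net.energyFactor α * E' n := by
    unfold excess
    split_ifs <;> simp
  have hexc0 := net.excess_nonneg (α := α) U' E' n s
  rw [hbat] at hexc'
  have hi2 : i ^ 2 ≤ (net.maxIn * net.Cm) ^ 2 := pow_le_pow_left₀ hi hiC 2
  have ha2 : a ^ 2 ≤ net.Am ^ 2 := pow_le_pow_left₀ ha haA 2
  have hai : a * i ≤ net.Am * (net.maxIn * net.Cm) := mul_le_mul haA hiC hi hAm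
  have hb2 : b ^ 2 ≤ (net.maxOut * net.Cm) ^ 2 := pow_le_pow_left₀ hb hbC 2
  rw [pressure_eq, queueLyapunov, queueLyapunov, h2]
  by_cases hcrit : net.Critical α U E n s
  · have h1 : net.excess α U E n s = U n s - net.energyFactor α * E n := if_pos hcrit
    have hB := (le_max_right _ _).trans
      (le_max_right (net.boundB0 α) (max (net.boundB1 α) (net.boundB2 α)))
    rw [h1]
    set 𝒞 := net.energyFactor α
    have hexc2 : net.excess α U' E' n s ^ 2 ≤
        (U n s - 𝒞 * E n + ((i + a + 𝒞 * p) - (b + 𝒞 * q))) ^ 2 := by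
      rcases hexc' with h | h
      · rw [h, zero_pow two_ne_zero]
        positivity
      · refine pow_le_pow_left₀ hexc0 ?_ 2
        rw [h]
        linarith
    -- Increases and decreases are grouped separately: their cross term has a favourable sign and is
    -- dropped.
    have hyz : ((i + a + 𝒞 * p) - (b + 𝒞 * q)) ^ 2 ≤ (i + a + 𝒞 * p) ^ 2 + (b + 𝒞 * q) ^ 2 := by
      have : 0 ≤ (i + a + 𝒞 * p) * (b + 𝒞 * q) := by positivity
      linarith
    have hyz2 : ((i + a) - b) ^ 2 ≤ (i + a) ^ 2 + b ^ 2 := by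
      have : 0 ≤ (i + a) * b := by positivity
      linarith
    have hp2 : (𝒞 * p) ^ 2 ≤ (𝒞 * (net.maxOut * net.Pm)) ^ 2 :=
      pow_le_pow_left₀ (by positivity) (by gcongr) 2
    have hq2 : (𝒞 * q) ^ 2 ≤ (𝒞 * net.PAPm) ^ 2 :=
      pow_le_pow_left₀ (by positivity) (by gcongr) 2
    have hip : i * (𝒞 * p) ≤ (net.maxIn * net.Cm) * (𝒞 * (net.maxOut * net.Pm)) := by
      gcongr
    have hap : a * (𝒞 * p) ≤ net.Am * (𝒞 * (net.maxOut * net.Pm)) := by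
      gcongr
    have hbq : b * (𝒞 * q) ≤ (net.maxOut * net.Cm) * (𝒞 * net.PAPm) := by
      gcongr
    have hfin : 1 / 2 * ((i + a + 𝒞 * p) ^ 2 + (b + 𝒞 * q) ^ 2) +
        1 / 2 * ((i + a) ^ 2 + b ^ 2) ≤ net.boundB2 α := by
      unfold boundB2
      linarith
    linarith
  · have h1 : net.excess α U E n s = 0 := if_neg hcrit
    have hUE : U n s ≤ net.energyFactor α * E n := by
      by_contra h
      exact hcrit (max_lt hcong (not_le.1 h))
    have hB := (le_max_left _ _).trans
      (le_max_right (net.boundB0 α) (max (net.boundB1 α) (net.boundB2 α)))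
    rw [h1]
    set 𝒞 := net.energyFactor α
    -- Since `U ≤ 𝒞 E` before the slot, a new excess can only come from the arriving data and the
    -- energy spent in this slot.
    have hexc2 : net.excess α U' E' n s ^ 2 ≤
        (net.Am + net.maxIn * net.Cm + 𝒞 * net.maxOut * net.Pm) ^ 2 := by
      refine pow_le_pow_left₀ hexc0 ?_ 2
      have hCp : 𝒞 * p ≤ 𝒞 * (net.maxOut * net.Pm) := mul_le_mul_of_nonneg_left hpP hC.le
      have hCq : 0 ≤ 𝒞 * q := by positivity
      rcases hexc' with h | h
      · rw [h]
        positivity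
      · rw [h]
        linarith
    have hyz2 : ((i + a) - b) ^ 2 ≤ (i + a) ^ 2 + b ^ 2 := by
      have : 0 ≤ (i + a) * b := by positivity
      linarith
    have hfin : 1 / 2 * ((i + a) ^ 2 + b ^ 2) +
        1 / 2 * (net.Am + net.maxIn * net.Cm + 𝒞 * net.maxOut * net.Pm) ^ 2 ≤
        net.boundB1 α := by
      unfold boundB1
      linarith
    linarith

lemma nextQueue_le (net : WPCN 𝕜 N S L M) {g : Fin L → 𝕜} {c : Control 𝕜 S L M}
    (hc : net.IsFeasible g c) {A : Arrivals N S} (hA : ∀ n s, 0 ≤ A n s)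
    (U : Fin N → Fin S → ℝ) (n : Fin N) (s : Fin S) :
    net.nextQueue c A U n s ≤ max (U n s - net.outflow c n s) 0 + net.inflow c n s + A n s := by
  unfold nextQueue
  split_ifs
  · have := hc.inflow_nonneg n s
    have := hA n s
    positivity
  · exact le_rfl

lemma nextQueue_nonneg (net : WPCN 𝕜 N S L M) {g : Fin L → 𝕜} {c : Control 𝕜 S L M}
    (hc : net.IsFeasible g c) {A : Arrivals N S} (hA : ∀ n s, 0 ≤ A n s)
    (U : Fin N → Fin S → ℝ) (n : Fin N) (s : Fin S) : 0 ≤ net.nextQueue c A U n s := by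
  unfold nextQueue
  split_ifs
  · exact le_rfl
  · have : 0 ≤ net.inflow c n s := hc.inflow_nonneg n s
    have := hA n s
    exact add_nonneg (add_nonneg (le_max_right _ _) (hc.inflow_nonneg n s)) (hA n s)

lemma lyapunov_drift_le (net : WPCN 𝕜 N S L M) {α : ℝ} (hα : 1 < α) (V : ℝ)
    {U : Fin N → Fin S → ℝ} {E : Fin N → ℝ}
    {g : Fin L → 𝕜} {h : Fin N → Fin M → 𝕜} (hh : ∀ n, ∑ m, ‖h n m‖ ^ 2 ≤ 1)
    {c : Control 𝕜 S L M} (hc : net.IsFeasible g c)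
    (hE' : ∀ n, 0 ≤ net.nextBattery c h E n)
    {A : Arrivals N S} (hA : ∀ n s, 0 ≤ A n s ∧ A n s ≤ net.Am) :
    net.lyapunov α (net.nextQueue c A U) (net.nextBattery c h E) + V * c.pAP ≤
      net.lyapunov α U E + net.boundB α + ∑ n, ∑ s, net.pressure α U E n s * A n s +
        net.cost V (net.pressure α U E) (net.powerCoeff α U E) h c := by
  have hA0 : ∀ n s, 0 ≤ A n s := fun n s => (hA n s).1
  have h1 : net.lyapunov α (net.nextQueue c A U) (net.nextBattery c h E) ≤
      ∑ n, ∑ s, (net.queueLyapunov α U E n s +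
      max (net.boundB0 α) (max (net.boundB1 α) (net.boundB2 α)) +
      net.pressure α U E n s * (net.inflow c n s + A n s - net.outflow c n s) +
      net.energyFactor α * net.excess α U E n s * (net.spent c n - received c h n)) := by
    refine Finset.sum_le_sum fun n _ => Finset.sum_le_sum fun s _ => ?_
    exact net.queueLyapunov_drift_le hα (net.nextQueue_nonneg hc hA0 U) hE' (hA n s).1
      (hA n s).2 (hc.inflow_nonneg n s) (hc.inflow_le n s) (hc.outflow_nonneg n s)
      (hc.outflow_le n s) (hc.outflow_le_linear n s) (hc.spent_nonneg n) (hc.spent_le n)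
      (hc.received_nonneg h n) (hc.received_le (hh n)) (net.nextQueue_le hc hA0 U n s) rfl
  have h2 : ∀ n, ∑ s, net.energyFactor α * net.excess α U E n s *
      (net.spent c n - received c h n) =
      net.powerCoeff α U E n * (net.spent c n - received c h n) := by
    intro n
    rw [powerCoeff_eq, Finset.mul_sum, Finset.sum_mul]
  have h3 : ∀ n s, net.pressure α U E n s * (net.inflow c n s + A n s - net.outflow c n s) =
      net.pressure α U E n s * A n s +
        net.pressure α U E n s * (net.inflow c n s - net.outflow c n s) := fun n s => by ring
  simp_rw [Finset.sum_add_distrib, h2, h3, Finset.sum_add_distrib] at h1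
  simp only [Finset.sum_const, Finset.card_univ, Fintype.card_fin, nsmul_eq_mul] at h1
  unfold cost lyapunov boundB at *
  linarith

end WPCN

/-! ### Decoupling a decision from the weights of a linear objective -/

/-- Let `Z` be bounded by the values of a linear functional, with random weights `θ` independent
of the state `X`, at all decisions that are feasible in state `X`. Then its mean is bounded
by the functional with mean weights, at the mean of any feasible decision taken in a state `X'`
with the law of `X`, possibly on another probability space. -/
theorem integral_le_sum_integral_mul_integral {Ω Ω' 𝓧 𝓒 ι : Type*} [MeasurableSpace Ω]
    [MeasurableSpace Ω'] [MeasurableSpace 𝓧] [MeasurableSpace 𝓒] [StandardBorelSpace 𝓒]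
    [Nonempty 𝓒] [Fintype ι] {μ : Measure Ω} [IsProbabilityMeasure μ] {μ' : Measure Ω'}
    [IsProbabilityMeasure μ'] {X : Ω → 𝓧} (hX : Measurable X) {X' : Ω' → 𝓧}
    (hX' : Measurable X') (hlaw : μ.map X = μ'.map X') {k : Ω' → 𝓒} (hk : Measurable k)
    {F : Set (𝓧 × 𝓒)} (hF : MeasurableSet F) (hkF : ∀ᵐ ω ∂μ', (X' ω, k ω) ∈ F)
    {D : ι → 𝓧 × 𝓒 → ℝ} (hDm : ∀ i, Measurable (D i))
    (hD : ∀ i, Integrable (fun ω => D i (X' ω, k ω)) μ')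
    {θ : ι → Ω → ℝ} (hθ : ∀ i, Integrable (θ i) μ) (hθX : ∀ i, IndepFun (θ i) X μ)
    {Z : Ω → ℝ} (hZ : Integrable Z μ)
    (hZle : ∀ᵐ ω ∂μ, ∀ d, (X ω, d) ∈ F → Z ω ≤ ∑ i, θ i ω * D i (X ω, d)) :
    ∫ ω, Z ω ∂μ ≤ ∑ i, (∫ ω, θ i ω ∂μ) * ∫ ω, D i (X' ω, k ω) ∂μ' := by
  -- The competitor's decision is seen as randomized given its channel state. As both states have
  -- the same law, `κ` can be evaluated at `X`.
  set κ := condDistrib k X' μ' with hκ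
  have hpair : Measurable fun ω => (X' ω, k ω) := hX'.prodMk hk
  have hprob : IsProbabilityMeasure (μ'.map X') :=
    Measure.isProbabilityMeasure_map hX'.aemeasurable
  have hcomp : μ'.map X' ⊗ₘ κ = μ'.map fun ω => (X' ω, k ω) :=
    compProd_map_condDistrib hk.aemeasurable
  have hF1 : ∀ᵐ x ∂(μ'.map X'), ∀ᵐ d ∂κ x, (x, d) ∈ F := by
    refine Measure.ae_ae_of_ae_compProd ?_
    rw [hcomp]
    exact (ae_map_iff (p := fun z => z ∈ F) hpair.aemeasurable (by simpa using hF)).2 hkF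
  have hD1 : ∀ i, Integrable (D i) (μ'.map X' ⊗ₘ κ) := by
    intro i
    rw [hcomp, integrable_map_measure (hDm i).aestronglyMeasurable hpair.aemeasurable]
    exact hD i
  have hD2 : ∀ i, ∀ᵐ x ∂(μ'.map X'), Integrable (fun d => D i (x, d)) (κ x) := fun i =>
    ((Measure.integrable_compProd_iff (hDm i).aestronglyMeasurable).1 (hD1 i)).1
  -- The conditional means depend on the state alone, so evaluated at `X` they are independent of
  -- the weights; this is what factors the expectations.
  set m : ι → 𝓧 → ℝ := fun i x => ∫ d, D i (x, d) ∂κ x with hm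
  have hmm : ∀ i, Measurable (m i) := fun i =>
    ((hDm i).stronglyMeasurable.integral_kernel_prod_right').measurable
  have hmi : ∀ i, Integrable (fun ω => m i (X ω)) μ := by
    intro i
    have h1 : Integrable (m i) (μ'.map X') :=
      ((Measure.integrable_compProd_iff (hDm i).aestronglyMeasurable).1 (hD1 i)).2.mono'
        (hmm i).aestronglyMeasurable (.of_forall fun x => norm_integral_le_integral_norm _)
    rw [← hlaw, integrable_map_measure (hmm i).aestronglyMeasurable hX.aemeasurable] at h1
    exact h1
  have hmean : ∀ i, ∫ ω, m i (X ω) ∂μ = ∫ ω, D i (X' ω, k ω) ∂μ' := by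
    intro i
    rw [← integral_map hX.aemeasurable (hmm i).aestronglyMeasurable, hlaw,
      ← Measure.integral_compProd (hD1 i), hcomp,
      integral_map hpair.aemeasurable (hDm i).aestronglyMeasurable]
  have hind : ∀ i, IndepFun (θ i) (fun ω => m i (X ω)) μ := fun i =>
    (hθX i).comp measurable_id (hmm i)
  have hprod : ∀ i, Integrable (fun ω => θ i ω * m i (X ω)) μ := fun i =>
    (hind i).integrable_mul (hθ i) (hmi i)
  have hle : ∀ᵐ ω ∂μ, Z ω ≤ ∑ i, θ i ω * m i (X ω) := by
    have hF2 : ∀ᵐ ω ∂μ, ∀ᵐ d ∂κ (X ω), (X ω, d) ∈ F := by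
      rw [← hlaw] at hF1
      exact ae_of_ae_map hX.aemeasurable hF1
    have hD3 : ∀ᵐ ω ∂μ, ∀ i, Integrable (fun d => D i (X ω, d)) (κ (X ω)) := by
      rw [ae_all_iff]
      intro i
      have h1 := hD2 i
      rw [← hlaw] at h1
      exact ae_of_ae_map hX.aemeasurable h1
    filter_upwards [hZle, hF2, hD3] with ω h1 h2 h3
    -- For fixed `ω` the pointwise bound holds at `κ`-almost every `d`; integrating over `d` leaves
    -- the constant `Z ω` unchanged.
    have h4 : ∀ i, Integrable (fun d => θ i ω * D i (X ω, d)) (κ (X ω)) := fun i =>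
      (h3 i).const_mul _
    have h5 : ∫ _d, Z ω ∂κ (X ω) ≤ ∫ d, ∑ i, θ i ω * D i (X ω, d) ∂κ (X ω) := by
      refine integral_mono_ae (integrable_const _) (integrable_finsetSum _ fun i _ => h4 i) ?_
      filter_upwards [h2] with d hd
      exact h1 d hd
    rw [integral_finsetSum _ fun i _ => h4 i] at h5
    simpa [integral_const_mul] using h5
  calc ∫ ω, Z ω ∂μ ≤ ∫ ω, ∑ i, θ i ω * m i (X ω) ∂μ :=
        integral_mono_ae hZ (integrable_finsetSum _ fun i _ => hprod i) hle
    _ = ∑ i, (∫ ω, θ i ω ∂μ) * ∫ ω, D i (X' ω, k ω) ∂μ' := by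
        rw [integral_finsetSum _ fun i _ => hprod i]
        refine Finset.sum_congr rfl fun i _ => ?_
        rw [(hind i).integral_fun_mul_eq_mul_integral (hθ i).aestronglyMeasurable
          (hmi i).aestronglyMeasurable, hmean]

namespace WPCN

variable {𝕜 : Type} [RCLike 𝕜] {N S L M : ℕ}

/-! ### Measurability -/

section measurability

variable {X : Type*} {mX : MeasurableSpace X} (net : WPCN 𝕜 N S L M) {c : X → Control 𝕜 S L M}

lemma measurable_outflow (hC : Measurable fun x => (c x).C) (n : Fin N) (s : Fin S) :
    Measurable fun x => net.outflow (c x) n s :=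
  Finset.measurable_sum _ fun l _ =>
    (measurable_pi_apply s).comp ((measurable_pi_apply l).comp hC)

lemma measurable_inflow (hC : Measurable fun x => (c x).C) (n : Fin N) (s : Fin S) :
    Measurable fun x => net.inflow (c x) n s :=
  Finset.measurable_sum _ fun l _ =>
    (measurable_pi_apply s).comp ((measurable_pi_apply l).comp hC)

lemma measurable_spent (hp : Measurable fun x => (c x).p) (n : Fin N) :
    Measurable fun x => net.spent (c x) n :=
  Finset.measurable_sum _ fun l _ => (measurable_pi_apply l).comp hp

lemma measurable_received {h : X → Fin N → Fin M → 𝕜} (hw : Measurable fun x => (c x).w)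
    (hpAP : Measurable fun x => (c x).pAP) (hh : Measurable h) (n : Fin N) :
    Measurable fun x => received (c x) (h x) n := by
  refine hpAP.mul (Measurable.pow_const (Measurable.norm ?_) 2)
  exact Finset.measurable_sum _ fun m _ => ((measurable_pi_apply m).comp hw).mul
    ((measurable_pi_apply m).comp ((measurable_pi_apply n).comp hh))

lemma measurable_nextQueue {A : X → Arrivals N S} {U : X → Fin N → Fin S → ℝ}
    (hC : Measurable fun x => (c x).C) (hA : Measurable A) (hU : Measurable U) :
    Measurable fun x => net.nextQueue (c x) (A x) (U x) := by
  refine measurable_pi_lambda _ fun n => measurable_pi_lambda _ fun s => ?_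
  unfold nextQueue
  split_ifs
  · exact measurable_const
  · exact ((((measurable_pi_apply s).comp ((measurable_pi_apply n).comp hU)).sub
      (net.measurable_outflow hC n s)).max measurable_const).add
      (net.measurable_inflow hC n s) |>.add
      ((measurable_pi_apply s).comp ((measurable_pi_apply n).comp hA))

lemma measurable_nextBattery {h : X → Fin N → Fin M → 𝕜} {E : X → Fin N → ℝ}
    (hp : Measurable fun x => (c x).p) (hw : Measurable fun x => (c x).w)
    (hpAP : Measurable fun x => (c x).pAP) (hh : Measurable h) (hE : Measurable E) :
    Measurable fun x => net.nextBattery (c x) (h x) (E x) :=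
  measurable_pi_lambda _ fun n => (((measurable_pi_apply n).comp hE).sub
    (net.measurable_spent hp n)).add (measurable_received hw hpAP hh n)

variable (α : ℝ) {U : X → Fin N → Fin S → ℝ} {E : X → Fin N → ℝ}

lemma measurable_excess (hU : Measurable U) (hE : Measurable E) (n : Fin N) (s : Fin S) :
    Measurable fun x => net.excess α (U x) (E x) n s := by
  have h1 : Measurable fun x => U x n s :=
    (measurable_pi_apply s).comp ((measurable_pi_apply n).comp hU)
  have h2 : Measurable fun x => net.energyFactor α * E x n :=
    ((measurable_pi_apply n).comp hE).const_mul _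
  exact Measurable.ite (measurableSet_lt (measurable_const.max h2) h1) (h1.sub h2)
    measurable_const

lemma measurable_congestedBacklog (hU : Measurable U) (n : Fin N) (s : Fin S) :
    Measurable fun x => net.congestedBacklog α (U x) n s := by
  have h1 : Measurable fun x => U x n s :=
    (measurable_pi_apply s).comp ((measurable_pi_apply n).comp hU)
  exact Measurable.ite (measurableSet_lt measurable_const h1) h1 measurable_const

lemma measurable_pressure (hU : Measurable U) (hE : Measurable E) (n : Fin N) (s : Fin S) :
    Measurable fun x => net.pressure α (U x) (E x) n s :=
  (net.measurable_excess α hU hE n s).add (net.measurable_congestedBacklog α hU n s)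

lemma measurable_powerCoeff (hU : Measurable U) (hE : Measurable E) (n : Fin N) :
    Measurable fun x => net.powerCoeff α (U x) (E x) n :=
  (Finset.measurable_sum _ fun s _ => net.measurable_excess α hU hE n s).const_mul _

lemma measurable_lyapunov (hU : Measurable U) (hE : Measurable E) :
    Measurable fun x => net.lyapunov α (U x) (E x) :=
  Finset.measurable_sum _ fun n _ => Finset.measurable_sum _ fun s _ =>
    (((net.measurable_excess α hU hE n s).pow_const 2).const_mul _).add
      (((net.measurable_congestedBacklog α hU n s).pow_const 2).const_mul _)

end measurability

/-- Decisions as points of a standard Borel space. -/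
abbrev ControlSpace (𝕜 : Type) (S L M : ℕ) : Type :=
  (Fin L → ℝ) × (Fin M → 𝕜) × ℝ × (Fin L → Fin S → ℝ)

/-- The decision given by a point of the control space. -/
def toControl (k : ControlSpace 𝕜 S L M) : Control 𝕜 S L M := ⟨k.1, k.2.1, k.2.2.1, k.2.2.2⟩

variable (𝕜) in
lemma standardBorelSpace_rclike : StandardBorelSpace 𝕜 :=
  have : ProperSpace 𝕜 := FiniteDimensional.proper_rclike 𝕜 𝕜
  inferInstance

/-- Feasibility has to be a measurable event to pass from the competitor's sample paths to its
conditional law; the Borel assumptions on `Π` and the capacities serve this purpose. -/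
lemma measurableSet_isFeasible (net : WPCN 𝕜 N S L M) :
    MeasurableSet {z : ChannelState 𝕜 N L M × ControlSpace 𝕜 S L M |
      net.IsFeasible z.1.1 (toControl z.2)} := by
  have hp : Measurable fun z : ChannelState 𝕜 N L M × ControlSpace 𝕜 S L M =>
      (toControl z.2).p := measurable_fst.comp measurable_snd
  have hw : ∀ m, Measurable fun z : ChannelState 𝕜 N L M × ControlSpace 𝕜 S L M =>
      (toControl z.2).w m := fun m =>
    (measurable_pi_apply m).comp (measurable_fst.comp (measurable_snd.comp measurable_snd))
  have hq : Measurable fun z : ChannelState 𝕜 N L M × ControlSpace 𝕜 S L M =>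
      (toControl z.2).pAP :=
    measurable_fst.comp (measurable_snd.comp (measurable_snd.comp measurable_snd))
  have hC : ∀ l s, Measurable fun z : ChannelState 𝕜 N L M × ControlSpace 𝕜 S L M =>
      (toControl z.2).C l s := fun l s =>
    (measurable_pi_apply s).comp ((measurable_pi_apply l).comp
      (measurable_snd.comp (measurable_snd.comp (measurable_snd.comp measurable_snd))))
  have hcap : ∀ l, Measurable fun z : ChannelState 𝕜 N L M × ControlSpace 𝕜 S L M =>
      net.cap (toControl z.2).p z.1.1 l := fun l =>
    (net.measurable_cap l).comp (hp.prodMk (measurable_fst.comp measurable_fst))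
  have heq : {z : ChannelState 𝕜 N L M × ControlSpace 𝕜 S L M |
      net.IsFeasible z.1.1 (toControl z.2)} =
      {z | (toControl z.2).p ∈ net.feasible} ∩ ({z | ∑ m, ‖(toControl z.2).w m‖ ^ 2 = 1} ∩
      ({z | 0 ≤ (toControl z.2).pAP} ∩ ({z | (toControl z.2).pAP ≤ net.PAPm} ∩
      ((⋂ l, ⋂ s, {z | 0 ≤ (toControl z.2).C l s}) ∩
      ⋂ l, {z | ∑ s, (toControl z.2).C l s ≤ net.cap (toControl z.2).p z.1.1 l})))) := by
    ext z
    simp only [Set.mem_ofPred_eq, Set.mem_inter_iff, Set.mem_iInter]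
    exact ⟨fun h => ⟨h.1, h.2, h.3, h.4, h.5, h.6⟩,
      fun ⟨h1, h2, h3, h4, h5, h6⟩ => ⟨h1, h2, h3, h4, h5, h6⟩⟩
  rw [heq]
  refine (hp net.measurableSet_feasible).inter (.inter ?_ (.inter ?_ (.inter ?_ (.inter ?_ ?_))))
  · exact measurableSet_eq_fun (Finset.measurable_sum _ fun m _ => (hw m).norm.pow_const 2)
      measurable_const
  · exact measurableSet_le measurable_const hq
  · exact measurableSet_le hq measurable_const
  · exact .iInter fun l => .iInter fun s => measurableSet_le measurable_const (hC l s)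
  · exact .iInter fun l => measurableSet_le (Finset.measurable_sum _ fun s _ => hC l s) (hcap l)

end WPCN

/-! ### Long run averages -/

lemma limsupAvg_le_of_sum_le {f : ℕ → ℝ} {a b : ℝ}
    (h : ∀ T : ℕ, ∑ t ∈ Finset.range T, f t ≤ a * T + b) : limsupAvg f ≤ (a : EReal) := by
  have hlim : Tendsto (fun T : ℕ => ((a + b / T : ℝ) : EReal)) atTop (nhds (a : EReal)) := by
    refine (continuous_coe_real_ereal.tendsto a).comp ?_
    simpa using tendsto_const_nhds.add (tendsto_const_div_atTop_nhds_zero_nat b)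
  rw [← hlim.limsup_eq]
  refine limsup_le_limsup ?_
  filter_upwards [eventually_gt_atTop 0] with T hT
  have hT' : (0 : ℝ) < T := by exact_mod_cast hT
  rw [EReal.coe_le_coe_iff, timeAvg, div_le_iff₀ hT', add_mul, div_mul_cancel₀ _ hT'.ne']
  exact h T

lemma eventually_sum_le_of_limsupAvg_lt {f : ℕ → ℝ} {a : ℝ} (h : limsupAvg f < (a : EReal)) :
    ∀ᶠ T : ℕ in atTop, ∑ t ∈ Finset.range T, f t ≤ a * T := by
  filter_upwards [eventually_lt_of_limsup_lt h, eventually_gt_atTop 0] with T hT hT0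
  have hT' : (0 : ℝ) < T := by exact_mod_cast hT0
  rw [EReal.coe_lt_coe_iff, timeAvg, div_lt_iff₀ hT'] at hT
  exact hT.le

lemma limsupAvg_mono {f g : ℕ → ℝ} (h : ∀ t, f t ≤ g t) : limsupAvg f ≤ limsupAvg g := by
  refine limsup_le_limsup (.of_forall fun T => ?_)
  rw [EReal.coe_le_coe_iff]
  exact div_le_div_of_nonneg_right (Finset.sum_le_sum fun t _ => h t) (Nat.cast_nonneg T)

/-- A nonnegative sequence with bounded averages is infinitely often sublinear. -/
lemma frequently_le_mul_of_limsupAvg_lt_top {f : ℕ → ℝ} (hf : ∀ t, 0 ≤ f t)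
    (h : limsupAvg f < ⊤) {η : ℝ} (hη : 0 < η) : ∃ᶠ T : ℕ in atTop, f T ≤ η * T := by
  obtain ⟨K, hK, -⟩ := EReal.lt_iff_exists_real_btwn.1 h
  intro hlt
  obtain ⟨T₀, hT₀⟩ := eventually_atTop.1 ((eventually_sum_le_of_limsupAvg_lt hK).and hlt)
  obtain ⟨k, hk⟩ := exists_nat_gt (2 * K / η)
  -- If `f t > η t` for all `t ≥ T₀`, the block `[m, 2m)` contributes at least `η m²`, while the sum
  -- up to `2m` is at most `2Km`. This fails once `m > 2K/η`.
  set m := max (max T₀ k) 1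
  have hm0 : T₀ ≤ m := (le_max_left _ _).trans (le_max_left _ _)
  have hmk : (k : ℝ) ≤ m := by exact_mod_cast (le_max_right T₀ k).trans (le_max_left _ _)
  have hm1 : (1 : ℝ) ≤ m := by exact_mod_cast le_max_right (max T₀ k) 1
  rw [div_lt_iff₀ hη] at hk
  have h1 : ∑ t ∈ Finset.range (m + m), f t ≤ K * (m + m : ℕ) := (hT₀ (m + m) (by omega)).1
  have h2 : ∑ i ∈ Finset.range m, f (m + i) ≤ ∑ t ∈ Finset.range (m + m), f t := by
    rw [Finset.sum_range_add]
    exact le_add_of_nonneg_left (Finset.sum_nonneg fun t _ => hf t)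
  have h3 : ∑ _i ∈ Finset.range m, η * m ≤ ∑ i ∈ Finset.range m, f (m + i) := by
    refine Finset.sum_le_sum fun i _ => ?_
    have h4 := (hT₀ (m + i) (by omega)).2
    rw [not_le] at h4
    refine le_trans ?_ h4.le
    push_cast
    have : 0 ≤ η * (i : ℝ) := by positivity
    linarith
  rw [Finset.sum_const, Finset.card_range, nsmul_eq_mul] at h3
  push_cast at h1
  have h5 : (m : ℝ) * (η * m) ≤ m * (2 * K) := by linarith
  have h6 := le_of_mul_le_mul_left h5 (by linarith)
  have h7 := mul_le_mul_of_nonneg_left hmk hη.le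
  linarith

namespace WPCN

variable {𝕜 : Type} [RCLike 𝕜] {N S L M : ℕ}

/-! ### Input and queue processes -/

section processes

variable {net : WPCN 𝕜 N S L M} {Ω : Type*} {mΩ : MeasurableSpace Ω} {μ : Measure Ω}
  {ℱ : Filtration ℕ mΩ} {ν : Measure (ChannelState 𝕜 N L M)} {ch : ℕ → Ω → ChannelState 𝕜 N L M}
  {A : ℕ → Ω → Arrivals N S} {c : ℕ → Ω → Control 𝕜 S L M} {U : ℕ → Ω → Fin N → Fin S → ℝ}

namespace IsIIDInput

lemma measurable_channel (hin : IsIIDInput μ ℱ ν ch A) (t : ℕ) : Measurable[ℱ (t + 1)] (ch t) :=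
  measurable_fst.comp (hin.adapted t)

lemma measurable_arrivals (hin : IsIIDInput μ ℱ ν ch A) (t : ℕ) :
    Measurable[ℱ (t + 1)] (A t) :=
  measurable_snd.comp (hin.adapted t)

lemma map_channel (hin : IsIIDInput μ ℱ ν ch A) (t : ℕ) : μ.map (ch t) = ν :=
  ((hin.ident t).comp measurable_fst).map_eq.trans hin.law

lemma ae_channel (hin : IsIIDInput μ ℱ ν ch A)
    (hν : ∀ᵐ x ∂ν, ∀ n, ∑ m, ‖x.2 n m‖ ^ 2 ≤ 1) (t : ℕ) :
    ∀ᵐ ω ∂μ, ∀ n, ∑ m, ‖(ch t ω).2 n m‖ ^ 2 ≤ 1 := by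
  rw [← hin.map_channel t] at hν
  exact ae_of_ae_map ((hin.measurable_channel t).mono (ℱ.le _) le_rfl).aemeasurable hν

/-- Non-anticipation in usable form: backlogs and batteries, hence all weights, are determined
before the slot and independent of its channel and arrivals. -/
lemma indepFun (hin : IsIIDInput μ ℱ ν ch A) {t : ℕ} {f : Ω → ℝ} (hf : Measurable[ℱ t] f)
    {β : Type*} [MeasurableSpace β] {φ : ChannelState 𝕜 N L M × Arrivals N S → β}
    (hφ : Measurable φ) : IndepFun f (fun ω => φ (ch t ω, A t ω)) μ := by
  rw [IndepFun_iff_Indep]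
  refine indep_of_indep_of_le_left (indep_of_indep_of_le_right (hin.indep t).symm ?_)
    hf.comap_le
  exact (hφ.comp (comap_measurable _)).comap_le

lemma integral_arrivals (hin : IsIIDInput μ ℱ ν ch A) (t : ℕ) (n : Fin N) (s : Fin S) :
    ∫ ω, A t ω n s ∂μ = ∫ ω, A 0 ω n s ∂μ :=
  ((hin.ident t).comp (u := fun z : ChannelState 𝕜 N L M × Arrivals N S => z.2 n s)
    (by fun_prop)).integral_eq

lemma integrable_arrivals [IsProbabilityMeasure μ] (hin : IsIIDInput μ ℱ ν ch A) {a : ℝ}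
    (hA : ∀ t ω n s, 0 ≤ A t ω n s ∧ A t ω n s ≤ a) (t : ℕ) (n : Fin N) (s : Fin S) :
    Integrable (fun ω => A t ω n s) μ := by
  refine Integrable.of_bound ((measurable_pi_apply s).comp ((measurable_pi_apply n).comp
    ((hin.measurable_arrivals t).mono (ℱ.le _) le_rfl))).aestronglyMeasurable a
    (.of_forall fun ω => ?_)
  rw [Real.norm_of_nonneg (hA t ω n s).1]
  exact (hA t ω n s).2

end IsIIDInput

namespace IsQueueProcess

lemma nonneg (hq : net.IsQueueProcess μ ℱ ch A c U) (hA : ∀ t ω n s, 0 ≤ A t ω n s) (t : ℕ)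
    (ω : Ω) (n : Fin N) (s : Fin S) : 0 ≤ U t ω n s := by
  cases t with
  | zero => exact hq.init_nonneg ω n s
  | succ t =>
    rw [hq.step]
    exact net.nextQueue_nonneg (hq.isFeasible t ω) (hA t ω) _ n s

lemma apply_dst (hq : net.IsQueueProcess μ ℱ ch A c U) (t : ℕ) (ω : Ω) (s : Fin S) :
    U t ω (net.dst s) s = 0 := by
  cases t with
  | zero => exact hq.init_dst ω s
  | succ t =>
    rw [hq.step]
    exact if_pos rfl

lemma measurable (hq : net.IsQueueProcess μ ℱ ch A c U) (hin : IsIIDInput μ ℱ ν ch A) (t : ℕ) :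
    Measurable[ℱ t] (U t) := by
  induction t with
  | zero => exact hq.init_measurable
  | succ t ih =>
    have h1 : U (t + 1) = fun ω => net.nextQueue (c t ω) (A t ω) (U t ω) := by
      funext ω n s
      exact hq.step t ω n s
    rw [h1]
    exact net.measurable_nextQueue (hq.measurable_C t) (hin.measurable_arrivals t)
      (ih.mono (ℱ.mono (Nat.le_succ t)) le_rfl)

lemma measurable_apply (hq : net.IsQueueProcess μ ℱ ch A c U) (hin : IsIIDInput μ ℱ ν ch A)
    (t : ℕ) (n : Fin N) (s : Fin S) : Measurable fun ω => U t ω n s :=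
  (measurable_pi_apply s).comp ((measurable_pi_apply n).comp
    ((hq.measurable hin t).mono (ℱ.le t) le_rfl))

lemma step_le (hq : net.IsQueueProcess μ ℱ ch A c U) {a : ℝ}
    (hA : ∀ t ω n s, 0 ≤ A t ω n s ∧ A t ω n s ≤ a) (t : ℕ) (ω : Ω) (n : Fin N) (s : Fin S) :
    U (t + 1) ω n s ≤ U t ω n s + (net.maxIn * net.Cm + a) := by
  have hc := hq.isFeasible t ω
  have h1 := net.nextQueue_le hc (fun n s => (hA t ω n s).1) (U t ω) n s
  have h2 : max (U t ω n s - net.outflow (c t ω) n s) 0 ≤ U t ω n s :=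
    max_le (by linarith [hc.outflow_nonneg n s]) (hq.nonneg (fun t ω n s => (hA t ω n s).1) t ω n s)
  rw [hq.step]
  linarith [hc.inflow_le n s, (hA t ω n s).2]

/-- A backlog grows by a bounded amount per slot, so moments of the initial state persist. Exponent
`1` serves arbitrary queue processes, exponent `2` the Lyapunov function. -/
lemma memLp [IsProbabilityMeasure μ] (hq : net.IsQueueProcess μ ℱ ch A c U)
    (hin : IsIIDInput μ ℱ ν ch A) {a : ℝ} (hA : ∀ t ω n s, 0 ≤ A t ω n s ∧ A t ω n s ≤ a)
    {p : ENNReal} (h0 : ∀ n s, MemLp (fun ω => U 0 ω n s) p μ) (t : ℕ) (n : Fin N)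
    (s : Fin S) : MemLp (fun ω => U t ω n s) p μ := by
  induction t with
  | zero => exact h0 n s
  | succ t ih =>
    refine (ih.add (memLp_const (net.maxIn * net.Cm + a))).mono
      (hq.measurable_apply hin _ n s).aestronglyMeasurable (.of_forall fun ω => ?_)
    have h1 := hq.nonneg (fun t ω n s => (hA t ω n s).1) (t + 1) ω n s
    have h2 := hq.step_le hA t ω n s
    rw [Real.norm_of_nonneg h1]
    exact h2.trans (Real.le_norm_self _)

lemma integrable [IsProbabilityMeasure μ] (hq : net.IsQueueProcess μ ℱ ch A c U)
    (hin : IsIIDInput μ ℱ ν ch A) {a : ℝ} (hA : ∀ t ω n s, 0 ≤ A t ω n s ∧ A t ω n s ≤ a)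
    (t : ℕ) (n : Fin N) (s : Fin S) : Integrable (fun ω => U t ω n s) μ := by
  have h0 : ∀ n s, MemLp (fun ω => U 0 ω n s) 1 μ := fun n s =>
    memLp_one_iff_integrable.2 (hq.init_integrable n s)
  exact memLp_one_iff_integrable.1 (hq.memLp hin hA h0 t n s)

variable [IsProbabilityMeasure μ]

lemma integrable_netflow (hq : net.IsQueueProcess μ ℱ ch A c U) (t : ℕ) (n : Fin N)
    (s : Fin S) :
    Integrable (fun ω => net.inflow (c t ω) n s - net.outflow (c t ω) n s) μ := by
  have hC : Measurable fun ω => (c t ω).C := (hq.measurable_C t).mono (ℱ.le _) le_rfl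
  refine (Integrable.of_bound (net.measurable_inflow hC n s).aestronglyMeasurable
    (net.maxIn * net.Cm) (.of_forall fun ω => ?_)).sub
    (Integrable.of_bound (net.measurable_outflow hC n s).aestronglyMeasurable
    (net.maxOut * net.Cm) (.of_forall fun ω => ?_))
  · rw [Real.norm_of_nonneg ((hq.isFeasible t ω).inflow_nonneg n s)]
    exact (hq.isFeasible t ω).inflow_le n s
  · rw [Real.norm_of_nonneg ((hq.isFeasible t ω).outflow_nonneg n s)]
    exact (hq.isFeasible t ω).outflow_le n s

lemma integrable_pAP (hq : net.IsQueueProcess μ ℱ ch A c U) (t : ℕ) :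
    Integrable (fun ω => (c t ω).pAP) μ := by
  refine Integrable.of_bound
    ((hq.measurable_pAP t).mono (ℱ.le _) le_rfl).aestronglyMeasurable net.PAPm
    (.of_forall fun ω => ?_)
  rw [Real.norm_of_nonneg (hq.isFeasible t ω).pAP_nonneg]
  exact (hq.isFeasible t ω).pAP_le

lemma integrable_spent (hq : net.IsQueueProcess μ ℱ ch A c U) (t : ℕ) (n : Fin N) :
    Integrable (fun ω => net.spent (c t ω) n) μ := by
  refine Integrable.of_bound (net.measurable_spent
    ((hq.measurable_p t).mono (ℱ.le _) le_rfl) n).aestronglyMeasurable net.Pm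
    (.of_forall fun ω => ?_)
  rw [Real.norm_of_nonneg ((hq.isFeasible t ω).spent_nonneg n)]
  exact (hq.isFeasible t ω).spent_le_Pm n

lemma integrable_received (hq : net.IsQueueProcess μ ℱ ch A c U) (hin : IsIIDInput μ ℱ ν ch A)
    (hν : ∀ᵐ x ∂ν, ∀ n, ∑ m, ‖x.2 n m‖ ^ 2 ≤ 1) (t : ℕ) (n : Fin N) :
    Integrable (fun ω => received (c t ω) (ch t ω).2 n) μ := by
  refine Integrable.of_bound (measurable_received
    ((hq.measurable_w t).mono (ℱ.le _) le_rfl) ((hq.measurable_pAP t).mono (ℱ.le _) le_rfl)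
    (measurable_snd.comp ((hin.measurable_channel t).mono (ℱ.le _) le_rfl)) n).aestronglyMeasurable
    net.PAPm ?_
  filter_upwards [hin.ae_channel hν t] with ω hω
  rw [Real.norm_of_nonneg ((hq.isFeasible t ω).received_nonneg _ n)]
  exact (hq.isFeasible t ω).received_le (hω n)

/-- Away from its destination, a stream is drained on average up to the remaining backlog. -/
lemma sum_netflow_add_le (hq : net.IsQueueProcess μ ℱ ch A c U) (hin : IsIIDInput μ ℱ ν ch A)
    {a : ℝ} (hA : ∀ t ω n s, 0 ≤ A t ω n s ∧ A t ω n s ≤ a) {n : Fin N} {s : Fin S}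
    (hn : n ≠ net.dst s) (T : ℕ) :
    ∑ t ∈ Finset.range T, ∫ ω, (net.inflow (c t ω) n s - net.outflow (c t ω) n s) ∂μ +
      T * ∫ ω, A 0 ω n s ∂μ ≤ ∫ ω, U T ω n s ∂μ := by
  have hA0 : ∀ t ω n s, 0 ≤ A t ω n s := fun t ω n s => (hA t ω n s).1
  induction T with
  | zero =>
    simpa using integral_nonneg fun ω => hq.nonneg hA0 0 ω n s
  | succ T ih =>
    have h1 : ∫ ω, (U T ω n s + (net.inflow (c T ω) n s - net.outflow (c T ω) n s) +
        A T ω n s) ∂μ ≤ ∫ ω, U (T + 1) ω n s ∂μ := by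
      refine integral_mono (((hq.integrable hin hA T n s).add
        (hq.integrable_netflow T n s)).add (hin.integrable_arrivals hA T n s))
        (hq.integrable hin hA (T + 1) n s) fun ω => ?_
      have h2 : U (T + 1) ω n s = max (U T ω n s - net.outflow (c T ω) n s) 0 +
          net.inflow (c T ω) n s + A T ω n s := by
        rw [hq.step, nextQueue, if_neg hn]
        rfl
      have h3 := le_max_left (U T ω n s - net.outflow (c T ω) n s) 0
      simp only
      linarith
    have hint : Integrable (fun ω => U T ω n s +
        (net.inflow (c T ω) n s - net.outflow (c T ω) n s)) μ :=
      (hq.integrable hin hA T n s).add (hq.integrable_netflow T n s)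
    rw [integral_add hint
      (hin.integrable_arrivals hA T n s), integral_add (hq.integrable hin hA T n s)
      (hq.integrable_netflow T n s), hin.integral_arrivals] at h1
    rw [Finset.sum_range_succ]
    push_cast
    linarith

end IsQueueProcess

/-! ### Comparison with stabilizing policies -/

/-- A lower bound for the costs of all decisions that are feasible in the current slot is on
average at most the cost of the decisions in any slot of any other network process with the
same channel law. -/
lemma integral_le_of_forall_le_cost [IsProbabilityMeasure μ]
    (hν : ∀ᵐ x ∂ν, ∀ n, ∑ m, ‖x.2 n m‖ ^ 2 ≤ 1) {X : Ω → ChannelState 𝕜 N L M}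
    (hX : Measurable X) (hlaw : μ.map X = ν) (V : ℝ)
    {x : Ω → Fin N → Fin S → ℝ} {y : Ω → Fin N → ℝ} {Z : Ω → ℝ}
    (hx : ∀ n s, Integrable (fun ω => x ω n s) μ) (hy : ∀ n, Integrable (fun ω => y ω n) μ)
    (hxX : ∀ n s, IndepFun (fun ω => x ω n s) X μ) (hyX : ∀ n, IndepFun (fun ω => y ω n) X μ)
    (hZ : Integrable Z μ)
    (hZle : ∀ᵐ ω ∂μ, ∀ d, net.IsFeasible (X ω).1 d → Z ω ≤ net.cost V (x ω) (y ω) (X ω).2 d)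
    {Ω' : Type*} {mΩ' : MeasurableSpace Ω'} {μ' : Measure Ω'} [IsProbabilityMeasure μ']
    {ℱ' : Filtration ℕ mΩ'} {ch' : ℕ → Ω' → ChannelState 𝕜 N L M} {A' : ℕ → Ω' → Arrivals N S}
    {c' : ℕ → Ω' → Control 𝕜 S L M} {U' : ℕ → Ω' → Fin N → Fin S → ℝ}
    (hin : IsIIDInput μ' ℱ' ν ch' A') (hq : net.IsQueueProcess μ' ℱ' ch' A' c' U') (t : ℕ) :
    ∫ ω, Z ω ∂μ ≤
      ∑ n, ∑ s, (∫ ω, x ω n s ∂μ) *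
        ∫ ω, (net.inflow (c' t ω) n s - net.outflow (c' t ω) n s) ∂μ' +
      ∑ n, (∫ ω, y ω n ∂μ) *
        (∫ ω, net.spent (c' t ω) n ∂μ' - ∫ ω, received (c' t ω) (ch' t ω).2 n ∂μ') +
      V * ∫ ω, (c' t ω).pAP ∂μ' := by
  have hchm : Measurable (ch' t) := (hin.measurable_channel t).mono (ℱ'.le _) le_rfl
  have hk : Measurable fun ω => (((c' t ω).p, (c' t ω).w, (c' t ω).pAP, (c' t ω).C) :
      ControlSpace 𝕜 S L M) :=
    ((hq.measurable_p t).mono (ℱ'.le _) le_rfl).prodMk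
      (((hq.measurable_w t).mono (ℱ'.le _) le_rfl).prodMk
      (((hq.measurable_pAP t).mono (ℱ'.le _) le_rfl).prodMk
      ((hq.measurable_C t).mono (ℱ'.le _) le_rfl)))
  have hp : Measurable fun z : ChannelState 𝕜 N L M × ControlSpace 𝕜 S L M =>
      (toControl z.2).p := measurable_fst.comp measurable_snd
  have hw : Measurable fun z : ChannelState 𝕜 N L M × ControlSpace 𝕜 S L M =>
      (toControl z.2).w := measurable_fst.comp (measurable_snd.comp measurable_snd)
  have hpAP : Measurable fun z : ChannelState 𝕜 N L M × ControlSpace 𝕜 S L M =>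
      (toControl z.2).pAP :=
    measurable_fst.comp (measurable_snd.comp (measurable_snd.comp measurable_snd))
  have hC : Measurable fun z : ChannelState 𝕜 N L M × ControlSpace 𝕜 S L M =>
      (toControl z.2).C :=
    measurable_snd.comp (measurable_snd.comp (measurable_snd.comp measurable_snd))
  -- The three terms of `cost` as one linear functional: data weights, energy weights, and the
  -- constant weight `V` on the EAP power.
  let D : (Fin N × Fin S) ⊕ (Fin N ⊕ Unit) →
      ChannelState 𝕜 N L M × ControlSpace 𝕜 S L M → ℝ
    | .inl i, z => net.inflow (toControl z.2) i.1 i.2 - net.outflow (toControl z.2) i.1 i.2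
    | .inr (.inl n), z => net.spent (toControl z.2) n - received (toControl z.2) z.1.2 n
    | .inr (.inr _), z => (toControl z.2).pAP
  let θ : (Fin N × Fin S) ⊕ (Fin N ⊕ Unit) → Ω → ℝ
    | .inl i, ω => x ω i.1 i.2
    | .inr (.inl n), ω => y ω n
    | .inr (.inr _), _ => V
  have hDm : ∀ i, Measurable (D i)
    | .inl i => (net.measurable_inflow hC i.1 i.2).sub (net.measurable_outflow hC i.1 i.2)
    | .inr (.inl n) => (net.measurable_spent hp n).sub
        (measurable_received hw hpAP (measurable_snd.comp measurable_fst) n)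
    | .inr (.inr _) => hpAP
  have hD : ∀ i, Integrable
      (fun ω => D i (ch' t ω, (c' t ω).p, (c' t ω).w, (c' t ω).pAP, (c' t ω).C)) μ'
    | .inl i => hq.integrable_netflow t i.1 i.2
    | .inr (.inl n) => (hq.integrable_spent t n).sub (hq.integrable_received hin hν t n)
    | .inr (.inr _) => hq.integrable_pAP t
  have hθ : ∀ i, Integrable (θ i) μ
    | .inl i => hx i.1 i.2
    | .inr (.inl n) => hy n
    | .inr (.inr _) => integrable_const V
  have hθX : ∀ i, IndepFun (θ i) X μ
    | .inl i => hxX i.1 i.2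
    | .inr (.inl n) => hyX n
    | .inr (.inr _) => indepFun_const_left V X
  -- Makes the control space standard Borel, so that a conditional law of the decision exists.
  have := standardBorelSpace_rclike 𝕜
  have key := integral_le_sum_integral_mul_integral hX hchm
    (hlaw.trans (hin.map_channel t).symm) hk net.measurableSet_isFeasible
    (.of_forall fun ω => hq.isFeasible t ω) hDm hD hθ hθX hZ (by
      filter_upwards [hZle] with ω h d hd
      refine (h _ hd).trans_eq ?_
      simp only [Fintype.sum_sum_type, Fintype.sum_prod_type, Finset.univ_unique,
        Finset.sum_singleton, cost, θ, D, add_assoc])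
  refine key.trans_eq ?_
  simp only [Fintype.sum_sum_type, Fintype.sum_prod_type, Finset.univ_unique,
    Finset.sum_singleton, add_assoc]
  congr 1
  congr 1
  · refine Finset.sum_congr rfl fun n _ => ?_
    rw [← integral_sub (hq.integrable_spent t n) (hq.integrable_received hin hν t n)]
    rfl
  · simp [θ, D, toControl]

/-- The left side does not depend on the competitor's slot, so the comparison may be averaged over
its first `T` slots. There its flows, energy deficits and powers are controlled up to an error `η`,
which is then sent to zero. -/
lemma StabilizableWith.integral_le [IsProbabilityMeasure μ]
    (hν : ∀ᵐ x ∂ν, ∀ n, ∑ m, ‖x.2 n m‖ ^ 2 ≤ 1) {X : Ω → ChannelState 𝕜 N L M}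
    (hX : Measurable X) (hlaw : μ.map X = ν) {V : ℝ} (hV : 0 ≤ V)
    {x : Ω → Fin N → Fin S → ℝ} {y : Ω → Fin N → ℝ} {Z : Ω → ℝ}
    (hx0 : ∀ ω n s, 0 ≤ x ω n s) (hxd : ∀ ω s, x ω (net.dst s) s = 0) (hy0 : ∀ ω n, 0 ≤ y ω n)
    (hx : ∀ n s, Integrable (fun ω => x ω n s) μ) (hy : ∀ n, Integrable (fun ω => y ω n) μ)
    (hxX : ∀ n s, IndepFun (fun ω => x ω n s) X μ) (hyX : ∀ n, IndepFun (fun ω => y ω n) X μ)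
    (hZ : Integrable Z μ)
    (hZle : ∀ᵐ ω ∂μ, ∀ d, net.IsFeasible (X ω).1 d → Z ω ≤ net.cost V (x ω) (y ω) (X ω).2 d)
    {r : Fin N → Fin S → ℝ} {P : ℝ} (h : net.StabilizableWith ν r P) :
    ∫ ω, Z ω ∂μ ≤ V * P - ∑ n, ∑ s, (∫ ω, x ω n s ∂μ) * r n s := by
  obtain ⟨Ω', mΩ', μ', hμ', ℱ', ch', A', c', U', hin, ⟨a, hA⟩, hr, hq, hstab, henergy, hpow⟩ := h
  have hEx0 : ∀ n s, 0 ≤ ∫ ω, x ω n s ∂μ := fun n s => integral_nonneg fun ω => hx0 ω n s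
  have hEy0 : ∀ n, 0 ≤ ∫ ω, y ω n ∂μ := fun n => integral_nonneg fun ω => hy0 ω n
  -- The sum of all coefficients that multiply the error `η`; below, `b + 1` serves as a positive
  -- denominator.
  set b : ℝ := ∑ n, ∑ s, ∫ ω, x ω n s ∂μ + ∑ n, ∫ ω, y ω n ∂μ + V with hb
  have hb0 : 0 ≤ b := add_nonneg (add_nonneg (Finset.sum_nonneg fun n _ =>
    Finset.sum_nonneg fun s _ => hEx0 n s) (Finset.sum_nonneg fun n _ => hEy0 n)) hV
  suffices hη : ∀ η : ℝ, 0 < η → ∫ ω, Z ω ∂μ ≤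
      V * P - ∑ n, ∑ s, (∫ ω, x ω n s ∂μ) * r n s + η * b by
    refine le_of_forall_pos_le_add fun ε hε => (hη (ε / (b + 1)) (by positivity)).trans ?_
    have : ε / (b + 1) * b ≤ ε := by
      rw [div_mul_eq_mul_div, div_le_iff₀ (by linarith)]
      linarith
    linarith
  intro η hη
  have hA0 : ∀ t ω n s, 0 ≤ A' t ω n s := fun t ω n s => (hA t ω n s).1
  have hU0 : ∀ t n s, 0 ≤ ∫ ω, U' t ω n s ∂μ' := fun t n s =>
    integral_nonneg fun ω => hq.nonneg hA0 t ω n s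
  have hf1 := frequently_le_mul_of_limsupAvg_lt_top (fun t => Finset.sum_nonneg fun n _ =>
    Finset.sum_nonneg fun s _ => hU0 t n s) hstab hη
  have hf2 := eventually_all.2 fun n => eventually_sum_le_of_limsupAvg_lt
    ((henergy n).trans_lt (EReal.coe_pos.2 hη))
  have hf3 := eventually_sum_le_of_limsupAvg_lt
    (hpow.trans_lt (EReal.coe_lt_coe_iff.2 (lt_add_of_pos_right P hη)))
  -- Stability makes the terminal backlog sublinear only for infinitely many `T`, while the energy
  -- and power bounds hold eventually; one common `T` is enough.
  obtain ⟨T, h1, h2, h3, hT⟩ :=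
    (hf1.and_eventually (hf2.and (hf3.and (eventually_gt_atTop 0)))).exists
  have hT' : (0 : ℝ) < T := by exact_mod_cast hT
  have hcmp := Finset.sum_le_sum fun t (_ : t ∈ Finset.range T) =>
    integral_le_of_forall_le_cost hν hX hlaw V hx hy hxX hyX hZ hZle hin hq t
  rw [Finset.sum_const, Finset.card_range, nsmul_eq_mul] at hcmp
  have hS1 : ∑ t ∈ Finset.range T, ∑ n, ∑ s, (∫ ω, x ω n s ∂μ) *
      ∫ ω, (net.inflow (c' t ω) n s - net.outflow (c' t ω) n s) ∂μ' ≤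
      ∑ n, ∑ s, (∫ ω, x ω n s ∂μ) * (T * (η - r n s)) := by
    rw [Finset.sum_comm]
    refine Finset.sum_le_sum fun n _ => ?_
    rw [Finset.sum_comm]
    refine Finset.sum_le_sum fun s _ => ?_
    rw [← Finset.mul_sum]
    -- At a destination data vanish and the flow balance fails, but there the weight is zero.
    by_cases hn : n = net.dst s
    · simp [hn, hxd]
    · refine mul_le_mul_of_nonneg_left ?_ (hEx0 n s)
      have h4 := hq.sum_netflow_add_le hin hA hn T
      have h5 : ∫ ω, U' T ω n s ∂μ' ≤ ∑ n, ∑ s, ∫ ω, U' T ω n s ∂μ' :=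
        (Finset.single_le_sum (f := fun s => ∫ ω, U' T ω n s ∂μ') (fun s _ => hU0 T n s)
          (Finset.mem_univ s)).trans
        (Finset.single_le_sum (f := fun n => ∑ s, ∫ ω, U' T ω n s ∂μ')
          (fun n _ => Finset.sum_nonneg fun s _ => hU0 T n s) (Finset.mem_univ n))
      rw [hr] at h4
      linarith
  have hS2 : ∑ t ∈ Finset.range T, ∑ n, (∫ ω, y ω n ∂μ) *
      (∫ ω, net.spent (c' t ω) n ∂μ' - ∫ ω, received (c' t ω) (ch' t ω).2 n ∂μ') ≤
      ∑ n, (∫ ω, y ω n ∂μ) * (η * T) := by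
    rw [Finset.sum_comm]
    refine Finset.sum_le_sum fun n _ => ?_
    rw [← Finset.mul_sum]
    exact mul_le_mul_of_nonneg_left (h2 n) (hEy0 n)
  have hS3 : ∑ t ∈ Finset.range T, V * ∫ ω, (c' t ω).pAP ∂μ' ≤ V * ((P + η) * T) := by
    rw [← Finset.mul_sum]
    exact mul_le_mul_of_nonneg_left h3 hV
  rw [Finset.sum_add_distrib, Finset.sum_add_distrib] at hcmp
  have hS1' : ∑ n, ∑ s, (∫ ω, x ω n s ∂μ) * (T * (η - r n s)) =
      T * (η * ∑ n, ∑ s, ∫ ω, x ω n s ∂μ - ∑ n, ∑ s, (∫ ω, x ω n s ∂μ) * r n s) := by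
    simp_rw [Finset.mul_sum, ← Finset.sum_sub_distrib, Finset.mul_sum]
    refine Finset.sum_congr rfl fun n _ => Finset.sum_congr rfl fun s _ => by ring
  have hS2' : ∑ n, (∫ ω, y ω n ∂μ) * (η * T) = T * (η * ∑ n, ∫ ω, y ω n ∂μ) := by
    rw [← Finset.sum_mul]
    ring
  refine le_of_mul_le_mul_left ?_ hT'
  rw [hb]
  linarith

end processes

end WPCN

namespace WPCN

variable {𝕜 : Type} [RCLike 𝕜] {N S L M : ℕ}

/-! ### Smaller arrival rates are easier to stabilize -/

lemma nextQueue_mono (net : WPCN 𝕜 N S L M) (c : Control 𝕜 S L M) {A A' : Arrivals N S}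
    {U U' : Fin N → Fin S → ℝ} {n : Fin N} {s : Fin S} (hA : A n s ≤ A' n s)
    (hU : U n s ≤ U' n s) : net.nextQueue c A U n s ≤ net.nextQueue c A' U' n s := by
  unfold nextQueue
  split_ifs
  · exact le_rfl
  · gcongr

/-- The backlogs that a sequence of decisions produces. -/
def queueProcess (net : WPCN 𝕜 N S L M) {Ω : Type*} (A : ℕ → Ω → Arrivals N S)
    (c : ℕ → Ω → Control 𝕜 S L M) (U₀ : Ω → Fin N → Fin S → ℝ) : ℕ → Ω → Fin N → Fin S → ℝ
  | 0 => U₀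
  | t + 1 => fun ω => net.nextQueue (c t ω) (A t ω) (queueProcess net A c U₀ t ω)

lemma IsIIDInput.map {Ω : Type*} {mΩ : MeasurableSpace Ω} {μ : Measure Ω}
    {ℱ : Filtration ℕ mΩ} {ν : Measure (ChannelState 𝕜 N L M)}
    {ch : ℕ → Ω → ChannelState 𝕜 N L M} {A : ℕ → Ω → Arrivals N S}
    (hin : IsIIDInput μ ℱ ν ch A) {φ : Arrivals N S → Arrivals N S} (hφ : Measurable φ) :
    IsIIDInput μ ℱ ν ch fun t ω => φ (A t ω) := by
  have hψ : Measurable fun z : ChannelState 𝕜 N L M × Arrivals N S => (z.1, φ z.2) :=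
    measurable_fst.prodMk (hφ.comp measurable_snd)
  exact ⟨fun t => hψ.comp (hin.adapted t),
    fun t => indep_of_indep_of_le_left (hin.indep t)
      (hψ.comp (comap_measurable fun ω => (ch t ω, A t ω))).comap_le,
    fun t => (hin.ident t).comp hψ, hin.law⟩

/-- Each arrival is multiplied by `r'/r` and the decisions are kept. Backlogs are monotone in the
arrivals, and energy use is unchanged. -/
lemma StabilizableWith.mono {net : WPCN 𝕜 N S L M} {ν : Measure (ChannelState 𝕜 N L M)}
    {r r' : Fin N → Fin S → ℝ} {P : ℝ} (h : net.StabilizableWith ν r P)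
    (h0 : ∀ n s, 0 ≤ r' n s) (hle : ∀ n s, r' n s ≤ r n s) : net.StabilizableWith ν r' P := by
  obtain ⟨Ω, mΩ, μ, hμ, ℱ, ch, A, c, U, hin, ⟨a, hA⟩, hr, hq, hstab, henergy, hpow⟩ := h
  -- If `r n s = 0`, then `r' n s = 0` as well, and the convention `0/0 = 0` gives the right mean.
  set κ : Fin N → Fin S → ℝ := fun n s => r' n s / r n s with hκ
  have hκ0 : ∀ n s, 0 ≤ κ n s := fun n s => div_nonneg (h0 n s) ((h0 n s).trans (hle n s))
  have hκ1 : ∀ n s, κ n s ≤ 1 := fun n s =>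
    div_le_one_of_le₀ (hle n s) ((h0 n s).trans (hle n s))
  have hφ : Measurable fun (A : Arrivals N S) (n : Fin N) (s : Fin S) => κ n s * A n s := by
    fun_prop
  have hAle : ∀ t ω n s, κ n s * A t ω n s ≤ A t ω n s := fun t ω n s =>
    mul_le_of_le_one_left (hA t ω n s).1 (hκ1 n s)
  have hA' : ∀ t ω n s, 0 ≤ κ n s * A t ω n s ∧ κ n s * A t ω n s ≤ a := fun t ω n s =>
    ⟨mul_nonneg (hκ0 n s) (hA t ω n s).1, (hAle t ω n s).trans (hA t ω n s).2⟩
  have hin' := hin.map hφ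
  set A' : ℕ → Ω → Arrivals N S := fun t ω n s => κ n s * A t ω n s
  set U' := net.queueProcess A' c (U 0)
  have hq' : net.IsQueueProcess μ ℱ ch A' c U' :=
    { measurable_p := hq.measurable_p
      measurable_w := hq.measurable_w
      measurable_pAP := hq.measurable_pAP
      measurable_C := hq.measurable_C
      isFeasible := hq.isFeasible
      init_measurable := hq.init_measurable
      init_nonneg := hq.init_nonneg
      init_dst := hq.init_dst
      init_integrable := hq.init_integrable
      step := fun _ _ _ _ => rfl }
  have hUle : ∀ t ω n s, U' t ω n s ≤ U t ω n s := by
    intro t ω n s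
    induction t with
    | zero => exact le_rfl
    | succ t ih =>
      rw [hq.step, hq'.step]
      exact net.nextQueue_mono _ (hAle t ω n s) ih
  refine ⟨Ω, mΩ, μ, hμ, ℱ, ch, A', c, U', hin', ⟨a, hA'⟩, fun n s => ?_, hq', ?_, henergy, hpow⟩
  · rw [integral_const_mul, hr]
    refine div_mul_cancel_of_imp fun h => ?_
    exact le_antisymm ((hle n s).trans_eq h) (h0 n s)
  · refine lt_of_le_of_lt (limsupAvg_mono fun t => Finset.sum_le_sum fun n _ =>
      Finset.sum_le_sum fun s _ => ?_) hstab
    exact integral_mono (hq'.integrable hin' hA' t n s) (hq.integrable hin hA t n s)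
      fun ω => hUle t ω n s

/-- The infimum need not be attained, so bounds against each admissible `P` are passed to it.
Membership in the capacity region makes the set nonempty, which suffices. -/
lemma le_coe_minPower (net : WPCN 𝕜 N S L M) {ν : Measure (ChannelState 𝕜 N L M)}
    {r : Fin N → Fin S → ℝ} (hr : r ∈ net.capacityRegion ν) {a b : ℝ} (ha : 0 < a) {X : EReal}
    (h : ∀ P, net.StabilizableWith ν r P → X ≤ ((a * P + b : ℝ) : EReal)) :
    X ≤ ((a * net.minPower ν r + b : ℝ) : EReal) := by
  obtain ⟨P₀, hP₀⟩ := hr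
  by_contra hX
  obtain ⟨z, hz1, hz2⟩ := EReal.lt_iff_exists_real_btwn.1 (not_le.1 hX)
  rw [EReal.coe_lt_coe_iff] at hz1
  have hlt : sInf {P | net.StabilizableWith ν r P} < (z - b) / a := by
    rw [lt_div_iff₀ ha]
    unfold minPower at hz1
    linarith
  obtain ⟨P, hP, hPlt⟩ := exists_lt_of_csInf_lt (s := {P | net.StabilizableWith ν r P})
    ⟨P₀, hP₀⟩ hlt
  rw [lt_div_iff₀ ha] at hPlt
  refine absurd (hz2.trans_le (h P hP)) (not_lt.2 ?_)
  rw [EReal.coe_le_coe_iff]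
  linarith

/-! ### The network under the proposed policy -/

namespace RunsProposedPolicy

variable {net : WPCN 𝕜 N S L M} {α V : ℝ} {Ω : Type*} {mΩ : MeasurableSpace Ω} {μ : Measure Ω}
  {ℱ : Filtration ℕ mΩ} {ν : Measure (ChannelState 𝕜 N L M)} {ch : ℕ → Ω → ChannelState 𝕜 N L M}
  {A : ℕ → Ω → Arrivals N S} {c : ℕ → Ω → Control 𝕜 S L M} {U : ℕ → Ω → Fin N → Fin S → ℝ}
  {E : ℕ → Ω → Fin N → ℝ}

lemma battery_nonneg_all (hrun : net.RunsProposedPolicy α V μ ℱ ch A c U E) (hα : 1 < α)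
    (t : ℕ) (ω : Ω) (n : Fin N) : 0 ≤ E t ω n := by
  induction t with
  | zero => exact hrun.battery_nonneg ω n
  | succ t ih =>
    rw [hrun.battery_step, nextBattery]
    have h1 := (hrun.data t ω).spent_le_battery hα ih
    have h2 := (hrun.queue.isFeasible t ω).received_nonneg (ch t ω).2 n
    linarith

lemma battery_measurable_all (hrun : net.RunsProposedPolicy α V μ ℱ ch A c U E)
    (hin : IsIIDInput μ ℱ ν ch A) (t : ℕ) : Measurable[ℱ t] (E t) := by
  induction t with
  | zero => exact hrun.battery_measurable
  | succ t ih =>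
    have h1 : E (t + 1) = fun ω => net.nextBattery (c t ω) (ch t ω).2 (E t ω) := by
      funext ω n
      exact hrun.battery_step t ω n
    rw [h1]
    exact net.measurable_nextBattery (hrun.queue.measurable_p t) (hrun.queue.measurable_w t)
      (hrun.queue.measurable_pAP t) (measurable_snd.comp (hin.measurable_channel t))
      (ih.mono (ℱ.mono (Nat.le_succ t)) le_rfl)

variable [IsProbabilityMeasure μ]

lemma integrable_pressure (hrun : net.RunsProposedPolicy α V μ ℱ ch A c U E) (hα : 1 < α)
    (hin : IsIIDInput μ ℱ ν ch A) {a : ℝ} (hA : ∀ t ω n s, 0 ≤ A t ω n s ∧ A t ω n s ≤ a)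
    (t : ℕ) (n : Fin N) (s : Fin S) :
    Integrable (fun ω => net.pressure α (U t ω) (E t ω) n s) μ := by
  refine ((hrun.queue.integrable hin hA t n s).const_mul 2).mono'
    ((net.measurable_pressure α (hrun.queue.measurable hin t)
    (hrun.battery_measurable_all hin t) n s).mono (ℱ.le t) le_rfl).aestronglyMeasurable
    (.of_forall fun ω => ?_)
  rw [Real.norm_of_nonneg (net.pressure_nonneg _ _ hα n s)]
  exact net.pressure_le hα (hrun.queue.nonneg (fun t ω n s => (hA t ω n s).1) t ω)
    (hrun.battery_nonneg_all hα t ω) n s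

lemma integrable_powerCoeff (hrun : net.RunsProposedPolicy α V μ ℱ ch A c U E) (hα : 1 < α)
    (hin : IsIIDInput μ ℱ ν ch A) {a : ℝ} (hA : ∀ t ω n s, 0 ≤ A t ω n s ∧ A t ω n s ≤ a)
    (t : ℕ) (n : Fin N) :
    Integrable (fun ω => net.powerCoeff α (U t ω) (E t ω) n) μ := by
  refine ((integrable_finsetSum Finset.univ fun s _ =>
    hrun.queue.integrable hin hA t n s).const_mul (net.energyFactor α)).mono'
    ((net.measurable_powerCoeff α (hrun.queue.measurable hin t)
    (hrun.battery_measurable_all hin t) n).mono (ℱ.le t) le_rfl).aestronglyMeasurable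
    (.of_forall fun ω => ?_)
  rw [Real.norm_of_nonneg (net.powerCoeff_nonneg _ _ hα n)]
  exact mul_le_mul_of_nonneg_left (Finset.sum_le_sum fun s _ =>
    net.excess_le hα (hrun.queue.nonneg (fun t ω n s => (hA t ω n s).1) t ω)
    (hrun.battery_nonneg_all hα t ω) n s) (net.energyFactor_pos hα).le

lemma integrable_lyapunov (hrun : net.RunsProposedPolicy α V μ ℱ ch A c U E) (hα : 1 < α)
    (hin : IsIIDInput μ ℱ ν ch A) {a : ℝ} (hA : ∀ t ω n s, 0 ≤ A t ω n s ∧ A t ω n s ≤ a)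
    (t : ℕ) : Integrable (fun ω => net.lyapunov α (U t ω) (E t ω)) μ := by
  refine (integrable_finsetSum Finset.univ fun n _ => integrable_finsetSum Finset.univ fun s _ =>
    (hrun.queue.memLp hin hA hrun.init_sq t n s).integrable_sq).mono'
    ((net.measurable_lyapunov α (hrun.queue.measurable hin t)
    (hrun.battery_measurable_all hin t)).mono (ℱ.le t) le_rfl).aestronglyMeasurable
    (.of_forall fun ω => ?_)
  rw [Real.norm_of_nonneg (net.lyapunov_nonneg α _ _)]
  exact Finset.sum_le_sum fun n _ => Finset.sum_le_sum fun s _ =>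
    net.queueLyapunov_le hα (hrun.queue.nonneg (fun t ω n s => (hA t ω n s).1) t ω)
    (hrun.battery_nonneg_all hα t ω) n s

/-- The drift-plus-penalty bound, against any policy that stabilizes rates `r`. -/
lemma integral_lyapunov_drift_le (hrun : net.RunsProposedPolicy α V μ ℱ ch A c U E) (hα : 1 < α)
    (hV : 0 ≤ V) (hν : ∀ᵐ x ∂ν, ∀ n, ∑ m, ‖x.2 n m‖ ^ 2 ≤ 1) (hin : IsIIDInput μ ℱ ν ch A)
    (hA : ∀ t ω n s, 0 ≤ A t ω n s ∧ A t ω n s ≤ net.Am) {r : Fin N → Fin S → ℝ} {P : ℝ}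
    (hr : net.StabilizableWith ν r P) (t : ℕ) :
    ∫ ω, net.lyapunov α (U (t + 1) ω) (E (t + 1) ω) ∂μ + V * ∫ ω, (c t ω).pAP ∂μ ≤
      ∫ ω, net.lyapunov α (U t ω) (E t ω) ∂μ + net.boundB α + V * P +
      ∑ n, ∑ s, (∫ ω, net.pressure α (U t ω) (E t ω) n s ∂μ) *
        (∫ ω, A 0 ω n s ∂μ - r n s) := by
  have hq := hrun.queue
  have hUm := hq.measurable hin t
  have hEm := hrun.battery_measurable_all hin t
  have hchm : Measurable (ch t) := (hin.measurable_channel t).mono (ℱ.le _) le_rfl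
  have hπm : ∀ n s, Measurable[ℱ t] fun ω => net.pressure α (U t ω) (E t ω) n s := fun n s =>
    net.measurable_pressure α hUm hEm n s
  have hJm : ∀ n, Measurable[ℱ t] fun ω => net.powerCoeff α (U t ω) (E t ω) n := fun n =>
    net.measurable_powerCoeff α hUm hEm n
  have hπ := hrun.integrable_pressure hα hin hA t
  have hL := hrun.integrable_lyapunov hα hin hA
  have hind : ∀ n s, IndepFun (fun ω => net.pressure α (U t ω) (E t ω) n s)
      (fun ω => A t ω n s) μ := fun n s =>
    hin.indepFun (hπm n s) (φ := fun z : ChannelState 𝕜 N L M × Arrivals N S => z.2 n s)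
      (by fun_prop)
  have hπA : ∀ n s, Integrable
      (fun ω => net.pressure α (U t ω) (E t ω) n s * A t ω n s) μ := fun n s =>
    (hind n s).integrable_mul (hπ n s) (hin.integrable_arrivals hA t n s)
  have hsum : Integrable
      (fun ω => ∑ n, ∑ s, net.pressure α (U t ω) (E t ω) n s * A t ω n s) μ :=
    integrable_finsetSum _ fun n _ => integrable_finsetSum _ fun s _ => hπA n s
  have hlhs : Integrable
      (fun ω => net.lyapunov α (U (t + 1) ω) (E (t + 1) ω) + V * (c t ω).pAP) μ :=
    (hL (t + 1)).add ((hq.integrable_pAP t).const_mul V)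
  have hrhs : Integrable (fun ω => net.lyapunov α (U t ω) (E t ω) + net.boundB α) μ :=
    (hL t).add (integrable_const _)
  have hrhs' : Integrable (fun ω => net.lyapunov α (U t ω) (E t ω) + net.boundB α +
      ∑ n, ∑ s, net.pressure α (U t ω) (E t ω) n s * A t ω n s) μ := hrhs.add hsum
  -- `Z` is the drift plus penalty minus every term that does not depend on the decision. It lies
  -- below the policy's own cost, hence below that of every feasible decision.
  have key := hr.integral_le (μ := μ) hν hchm (hin.map_channel t) hV
    (x := fun ω => net.pressure α (U t ω) (E t ω))
    (y := fun ω => net.powerCoeff α (U t ω) (E t ω))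
    (Z := fun ω => (net.lyapunov α (U (t + 1) ω) (E (t + 1) ω) + V * (c t ω).pAP) -
      (net.lyapunov α (U t ω) (E t ω) + net.boundB α +
      ∑ n, ∑ s, net.pressure α (U t ω) (E t ω) n s * A t ω n s))
    (fun ω n s => net.pressure_nonneg _ _ hα n s)
    -- The queue at a destination is empty, and `0 ≤ π ≤ 2U` forces zero pressure there.
    (fun ω s => by
      have h1 := net.pressure_nonneg (U t ω) (E t ω) hα (net.dst s) s
      have h2 := net.pressure_le hα (hq.nonneg (fun t ω n s => (hA t ω n s).1) t ω)
        (hrun.battery_nonneg_all hα t ω) (net.dst s) s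
      rw [hq.apply_dst] at h2
      linarith)
    (fun ω n => net.powerCoeff_nonneg _ _ hα n) hπ (hrun.integrable_powerCoeff hα hin hA t)
    (fun n s => hin.indepFun (hπm n s) measurable_fst)
    (fun n => hin.indepFun (hJm n) measurable_fst) (hlhs.sub hrhs')
    (by
      filter_upwards [hin.ae_channel hν t] with ω hω d hd
      have hU' : U (t + 1) ω = net.nextQueue (c t ω) (A t ω) (U t ω) := by
        funext n s
        exact hq.step t ω n s
      have hE' : E (t + 1) ω = net.nextBattery (c t ω) (ch t ω).2 (E t ω) := by
        funext n
        exact hrun.battery_step t ω n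
      have h1 := net.lyapunov_drift_le hα V (U := U t ω) hω (hq.isFeasible t ω)
        (E := E t ω) (fun n => hE' ▸ hrun.battery_nonneg_all hα (t + 1) ω n) (hA t ω)
      have h2 := cost_le_of_policy hα (hrun.data t ω) (hrun.energy t ω) hd
      rw [hU', hE']
      linarith)
  rw [integral_sub hlhs hrhs', integral_add (hL (t + 1)) ((hq.integrable_pAP t).const_mul V),
    integral_const_mul, integral_add hrhs hsum, integral_add (hL t) (integrable_const _),
    integral_const, probReal_univ, one_smul,
    integral_finsetSum _ fun n _ => integrable_finsetSum _ fun s _ => hπA n s] at key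
  have h3 : ∀ n, ∫ ω, ∑ s, net.pressure α (U t ω) (E t ω) n s * A t ω n s ∂μ =
      ∑ s, (∫ ω, net.pressure α (U t ω) (E t ω) n s ∂μ) * ∫ ω, A 0 ω n s ∂μ := by
    intro n
    rw [integral_finsetSum _ fun s _ => hπA n s]
    refine Finset.sum_congr rfl fun s _ => ?_
    rw [(hind n s).integral_fun_mul_eq_mul_integral (hπ n s).aestronglyMeasurable
      (hin.integrable_arrivals hA t n s).aestronglyMeasurable, hin.integral_arrivals]
  simp_rw [h3] at key
  simp_rw [mul_sub, Finset.sum_sub_distrib]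
  linarith

/-- The average EAP power exceeds that of any policy stabilizing the arrival rates by at most
`B / V`. -/
lemma avgPower_le (hrun : net.RunsProposedPolicy α V μ ℱ ch A c U E) (hα : 1 < α) (hV : 0 < V)
    (hν : ∀ᵐ x ∂ν, ∀ n, ∑ m, ‖x.2 n m‖ ^ 2 ≤ 1) (hin : IsIIDInput μ ℱ ν ch A)
    (hA : ∀ t ω n s, 0 ≤ A t ω n s ∧ A t ω n s ≤ net.Am) {P : ℝ}
    (hP : net.StabilizableWith ν (fun n s => ∫ ω, A 0 ω n s ∂μ) P) :
    avgPower μ c ≤ ((1 * P + net.boundB α / V : ℝ) : EReal) := by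
  have h1 : ∀ T : ℕ, ∫ ω, net.lyapunov α (U T ω) (E T ω) ∂μ +
      V * ∑ t ∈ Finset.range T, ∫ ω, (c t ω).pAP ∂μ ≤
      ∫ ω, net.lyapunov α (U 0 ω) (E 0 ω) ∂μ + (net.boundB α + V * P) * T := by
    intro T
    induction T with
    | zero => simp
    | succ T ih =>
      have h2 := hrun.integral_lyapunov_drift_le hα hV.le hν hin hA hP T
      simp only [sub_self, mul_zero, Finset.sum_const_zero, add_zero] at h2
      rw [Finset.sum_range_succ]
      push_cast
      linarith
  refine limsupAvg_le_of_sum_le (b := (∫ ω, net.lyapunov α (U 0 ω) (E 0 ω) ∂μ) / V) fun T => ?_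
  have h3 : 0 ≤ ∫ ω, net.lyapunov α (U T ω) (E T ω) ∂μ :=
    integral_nonneg fun ω => net.lyapunov_nonneg α _ _
  refine le_of_mul_le_mul_left ?_ hV
  have h4 : V * ((1 * P + net.boundB α / V) * T +
      (∫ ω, net.lyapunov α (U 0 ω) (E 0 ω) ∂μ) / V) =
      ∫ ω, net.lyapunov α (U 0 ω) (E 0 ω) ∂μ + (net.boundB α + V * P) * T := by
    field_simp
    ring
  rw [h4]
  linarith [h1 T]

/-- The slack `ε` in the rates leaves `-ε` times the total mean pressure in the drift. Pressure
controls backlog up to `U₀` per queue, and the EAP power on the left is discarded. -/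
lemma avgBacklog_le (hrun : net.RunsProposedPolicy α V μ ℱ ch A c U E) (hα : 1 < α) (hV : 0 ≤ V)
    (hν : ∀ᵐ x ∂ν, ∀ n, ∑ m, ‖x.2 n m‖ ^ 2 ≤ 1) (hin : IsIIDInput μ ℱ ν ch A)
    (hA : ∀ t ω n s, 0 ≤ A t ω n s ∧ A t ω n s ≤ net.Am) {ε : ℝ} (hε : 0 < ε) {P : ℝ}
    (hP : net.StabilizableWith ν (fun n s => ∫ ω, A 0 ω n s ∂μ + ε) P) :
    avgBacklog μ U ≤
      ((V / ε * P + (net.boundB α + ε * N * S * net.threshold α) / ε : ℝ) : EReal) := by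
  have hq := hrun.queue
  have hpr : ∀ t, ∑ n, ∑ s, ∫ ω, U t ω n s ∂μ ≤
      ∑ n, ∑ s, ∫ ω, net.pressure α (U t ω) (E t ω) n s ∂μ + N * S * net.threshold α := by
    intro t
    have h1 : ∑ n, ∑ s, ∫ ω, U t ω n s ∂μ ≤ ∑ n : Fin N, ∑ s : Fin S,
        (∫ ω, net.pressure α (U t ω) (E t ω) n s ∂μ + net.threshold α) := by
      refine Finset.sum_le_sum fun n _ => Finset.sum_le_sum fun s _ => ?_
      have hπ := hrun.integrable_pressure hα hin hA t n s
      have h2 := integral_mono (hq.integrable hin hA t n s)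
        (hπ.add (integrable_const (net.threshold α))) fun ω => by
          have h3 := net.le_congestedBacklog_add (U := U t ω) hα n s
          have h4 := net.excess_nonneg (α := α) (U t ω) (E t ω) n s
          simp only [Pi.add_apply, pressure_eq]
          linarith
      rw [integral_add' hπ (integrable_const _), integral_const, probReal_univ, one_smul] at h2
      exact h2
    simp only [Finset.sum_add_distrib, Finset.sum_const, Finset.card_univ, Fintype.card_fin,
      nsmul_eq_mul] at h1
    linarith
  have h1 : ∀ T : ℕ, ∫ ω, net.lyapunov α (U T ω) (E T ω) ∂μ +
      ε * ∑ t ∈ Finset.range T, ∑ n, ∑ s, ∫ ω, U t ω n s ∂μ ≤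
      ∫ ω, net.lyapunov α (U 0 ω) (E 0 ω) ∂μ +
      (V * P + (net.boundB α + ε * N * S * net.threshold α)) * T := by
    intro T
    induction T with
    | zero => simp
    | succ T ih =>
      have h2 := hrun.integral_lyapunov_drift_le hα hV hν hin hA hP T
      simp only [sub_add_cancel_left, mul_neg, Finset.sum_neg_distrib, ← Finset.sum_mul] at h2
      have h3 : 0 ≤ V * ∫ ω, (c T ω).pAP ∂μ :=
        mul_nonneg hV (integral_nonneg fun ω => (hq.isFeasible T ω).pAP_nonneg)
      have h4 := mul_le_mul_of_nonneg_left (hpr T) hε.le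
      rw [Finset.sum_range_succ]
      push_cast
      linarith
  refine limsupAvg_le_of_sum_le (b := (∫ ω, net.lyapunov α (U 0 ω) (E 0 ω) ∂μ) / ε) fun T => ?_
  have h3 : 0 ≤ ∫ ω, net.lyapunov α (U T ω) (E T ω) ∂μ :=
    integral_nonneg fun ω => net.lyapunov_nonneg α _ _
  refine le_of_mul_le_mul_left ?_ hε
  have h4 : ε * ((V / ε * P + (net.boundB α + ε * N * S * net.threshold α) / ε) * T +
      (∫ ω, net.lyapunov α (U 0 ω) (E 0 ω) ∂μ) / ε) =
      ∫ ω, net.lyapunov α (U 0 ω) (E 0 ω) ∂μ +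
      (V * P + (net.boundB α + ε * N * S * net.threshold α)) * T := by
    field_simp
    ring
  rw [h4]
  linarith [h1 T]

end RunsProposedPolicy

end WPCN

end

/-! ### Assembling the theorem -/

theorem theorem2 {𝕜 : Type} [RCLike 𝕜] {N S L M : ℕ} (net : WPCN 𝕜 N S L M)
    (ν : Measure (ChannelState 𝕜 N L M))
    (hν : ∀ᵐ x ∂ν, ∀ n, ∑ m, ‖x.2 n m‖ ^ 2 ≤ 1)
    (α V εmax : ℝ) (hα : 1 < α) (hV : 0 < V) (hεmax : 0 < εmax)
    {Ω : Type*} [mΩ : MeasurableSpace Ω] (μ : Measure Ω) [IsProbabilityMeasure μ]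
    (ℱ : Filtration ℕ mΩ)
    (ch : ℕ → Ω → ChannelState 𝕜 N L M) (A : ℕ → Ω → Arrivals N S)
    (c : ℕ → Ω → Control 𝕜 S L M)
    (U : ℕ → Ω → Fin N → Fin S → ℝ) (E : ℕ → Ω → Fin N → ℝ)
    (hinput : WPCN.IsIIDInput μ ℱ ν ch A)
    (hA : ∀ t ω n s, 0 ≤ A t ω n s ∧ A t ω n s ≤ net.Am)
    (hsrc : ∀ t ω n s, n ≠ net.src s → A t ω n s = 0)
    (lam : Fin N → Fin S → ℝ) (hlam : ∀ n s, ∫ ω, A 0 ω n s ∂μ = lam n s)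
    (hcap : ∀ ε ∈ Set.Ioc 0 εmax, (fun n s => lam n s + ε) ∈ net.capacityRegion ν)
    (hrun : net.RunsProposedPolicy α V μ ℱ ch A c U E) :
    ((∀ t ω l, (c t ω).p l ≠ 0 → net.Pm < E t ω (net.tx l)) ∧
      (∀ t ω n, ∑ l with net.tx l = n, (c t ω).p l ≤ E t ω n)) ∧
    WPCN.avgPower μ c ≤ ((net.minPower ν lam + net.boundB α / V : ℝ) : EReal) ∧
    (WPCN.avgBacklog μ U < ⊤ ∧
      WPCN.avgBacklog μ U ≤
        (((V * net.minPower ν (fun n s => lam n s + εmax) +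
          (net.boundB α + εmax * N * S * net.threshold α)) / εmax : ℝ) : EReal)) := by
  have hlam' : lam = fun n s => ∫ ω, A 0 ω n s ∂μ := by
    funext n s
    exact (hlam n s).symm
  have hmem := hcap εmax ⟨hεmax, le_rfl⟩
  -- Rates `λ` are nonnegative and lie below `λ + ε_max`, so scaling the arrivals down shows that
  -- they are stabilizable too; `p*_AP(λ)` is then the infimum of a nonempty set.
  have hmem0 : lam ∈ net.capacityRegion ν := by
    obtain ⟨P, hP⟩ := hmem
    refine ⟨P, hP.mono (fun n s => ?_) fun n s => by linarith⟩
    rw [← hlam]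
    exact integral_nonneg fun ω => (hA 0 ω n s).1
  have hback := net.le_coe_minPower hmem (X := WPCN.avgBacklog μ U) (div_pos hV hεmax) fun P hP =>
    hrun.avgBacklog_le hα hV.le hν hinput hA hεmax (by simpa only [hlam'] using hP)
  rw [div_mul_eq_mul_div, ← add_div] at hback
  refine ⟨⟨fun t ω l hl => (hrun.data t ω).lt_battery hα hl, fun t ω n =>
    (hrun.data t ω).spent_le_battery hα (hrun.battery_nonneg_all hα t ω n)⟩, ?_,
    hback.trans_lt (EReal.coe_lt_top _), hback⟩
  have hpow := net.le_coe_minPower hmem0 (X := WPCN.avgPower μ c) one_pos fun P hP =>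
    hrun.avgPower_le hα hV hν hinput hA (hlam' ▸ hP)
  rwa [one_mul] at hpow
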